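/- Let $E$ be a real Banach lattice, with norm dual $E'$. A sequence $(x_n)$ in $E$ is disjoint if $|x_m|\wedge|x_n|=0$ for all $m\neq n$. A bounded set $A\subset E$ is called disjointly weakly compact if every disjoint sequence in its solid hull $\{y\in E : |y|\le |x| \text{ for some } x\in A\}$ converges weakly to $0$. A bounded set $A\subset E$ is called limited if every weak$^*$-null sequence $(f_n)\subset E'$ converges to $0$ uniformly on $A$, that is, $\sup_{x\in A}|f_n(x)|\to 0$. The lattice $E$ has the (d)-DP$^*$ property if every disjointly weakly compact subset of $E$ is limited. It has the Schur property if every weakly null sequence in $E$ is norm null. Its norm is order continuous if $\|x_\alpha\|\to 0$ for every net $x_\alpha\downarrow 0$ in $E$. It is $\sigma$-Dedekind complete if every nonempty countable subset of $E$ that is bounded above has a supremum. **Theorem.** For every real Banach lattice $E$ the following statements are equivalent: 1. $E$ has the Schur property. 2. $E$ has the (d)-DP$^*$ property and order continuous norm. 3. $E$ is $\sigma$-Dedekind complete and has the (d)-DP$^*$ property. -/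

import Mathlib

open Filter Topology

/-- A sequence of a normed space is weakly null: it converges to `0` in the weak topology. -/
def WeaklyNull {X : Type*} [NormedAddCommGroup X] [NormedSpace ℝ X] (x : ℕ → X) : Prop :=
  Tendsto (fun n => toWeakSpace ℝ X (x n)) atTop (𝓝 0)

/-- A sequence of functionals is weak-star null: it converges to `0` in the weak-star topology
of the norm dual. -/
def WeakStarNull {X : Type*} [NormedAddCommGroup X] [NormedSpace ℝ X]
    (f : ℕ → StrongDual ℝ X) : Prop :=
  Tendsto (fun n => StrongDual.toWeakDual (f n)) atTop (𝓝 0)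

/-- The Schur property: every weakly null sequence is norm null. -/
def HasSchurProperty (X : Type*) [NormedAddCommGroup X] [NormedSpace ℝ X] : Prop :=
  ∀ x : ℕ → X, WeaklyNull x → Tendsto x atTop (𝓝 0)

/-- A limited set: a bounded set on which every weak-star null sequence of functionals converges
uniformly to `0`. -/
def IsLimitedSet {X : Type*} [NormedAddCommGroup X] [NormedSpace ℝ X] (A : Set X) : Prop :=
  Bornology.IsBounded A ∧
    ∀ f : ℕ → StrongDual ℝ X, WeakStarNull f →
      TendstoUniformlyOn (fun n x => f n x) (fun _ => (0 : ℝ)) atTop A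

/-- A disjoint sequence of a vector lattice: distinct terms are lattice-disjoint. -/
def IsDisjointSeq {E : Type*} [AddCommGroup E] [Lattice E] (x : ℕ → E) : Prop :=
  ∀ m n : ℕ, m ≠ n → |x m| ⊓ |x n| = 0

/-- A disjointly weakly compact set: a bounded set such that every disjoint sequence in its solid
hull `{y | ∃ x ∈ A, |y| ≤ |x|}` is weakly null. -/
def IsDisjointlyWeaklyCompact {E : Type*} [NormedAddCommGroup E] [NormedSpace ℝ E] [Lattice E]
    (A : Set E) : Prop :=
  Bornology.IsBounded A ∧
    ∀ x : ℕ → E, (∀ n, x n ∈ LatticeOrderedAddCommGroup.solidClosure A) →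
      IsDisjointSeq x → WeaklyNull x

/-- The (d)-DP* property: every disjointly weakly compact set is limited. -/
def HasDDPStarProperty (E : Type*) [NormedAddCommGroup E] [NormedSpace ℝ E] [Lattice E] : Prop :=
  ∀ A : Set E, IsDisjointlyWeaklyCompact A → IsLimitedSet A

/-- Order continuity of the norm: every net decreasing to `0` is norm null. Since the norm is
monotone on the positive cone, only the range of the net matters, so this is stated for
downward directed sets with infimum `0`; this also avoids quantifying over index types. -/
def HasOrderContinuousNorm (E : Type*) [NormedAddCommGroup E] [Lattice E] : Prop :=
  ∀ D : Set E, D.Nonempty → DirectedOn (· ≥ ·) D → IsGLB D 0 →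
    ∀ ε : ℝ, 0 < ε → ∃ x ∈ D, ‖x‖ < ε

/-- σ-Dedekind completeness: every nonempty countable set that is bounded above has a supremum. -/
def IsSigmaDedekindComplete (E : Type*) [Lattice E] : Prop :=
  ∀ S : Set E, S.Nonempty → S.Countable → BddAbove S → ∃ s : E, IsLUB S s

set_option linter.unusedSectionVars false

/-! ### Disjointness and Riesz decomposition in lattice-ordered groups. -/

section LatticeGroup

variable {E : Type*} [AddCommGroup E] [Lattice E] [IsOrderedAddMonoid E]

/-! The pivot is `MonotoneSeqCauchy`: increasing order bounded sequences are norm Cauchy. In a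
Banach lattice this is equivalent to order continuity of the norm, and it implies σ-Dedekind
completeness. The Schur property yields it because every functional is absolutely summable on the
increments of such a sequence.

From σ-Dedekind completeness and (d)-DP*, the pivot is reached as follows. Order bounded disjoint
sequences are weakly null, so order intervals are disjointly weakly compact, hence limited. Suppose
a disjoint sequence in `[-u, u]` has norms at least `δ`; index it as `x s` by finite sets `s` of
naturals. Take functionals `f s` norming `x s` and carried by its band, and weak-star limits `h j`
of the averages of `r_j(s) f s` with Rademacher signs. Bessel's inequality makes `h` weak-star null,
while the signed order sums `w j` of the `x s` lie in `[-u, u]` and satisfy `h j (w j) ≥ δ`, a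
contradiction (`orderBoundedDisjointNull_of_limited`). So order bounded disjoint sequences are norm
null, and an approximation by components gives the pivot.

Given the pivot, limited order intervals, or the Schur property, make order intervals norm compact
(`MonotoneSeqCauchy.orderIntervalsCompact`). A positive functional `φ` controls the norm on an order
interval, and `√φ(x²/u)` is a Hilbert seminorm on the ideal of `u`. Bounded sequences in a Hilbert
space have weakly Cauchy subsequences, and the hypothesis upgrades this to norm convergence.

Finally, a bounded set whose solid hull has only norm null disjoint sequences lies within any `ε` of
an order interval. Under the Schur property every disjointly weakly compact set is of this kind, so
it is nearly compact and therefore limited. Conversely, the solid hull of a weakly null sequence is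
disjointly weakly compact by a gliding hump; under (d)-DP* it is limited, its disjoint sequences are
norm null, and the sequence is nearly contained in a compact interval, where weak nullity forces
norm nullity. -/

theorem add_inf_le_inf_add_inf {a b c : E} (ha : 0 ≤ a) (hb : 0 ≤ b) (hc : 0 ≤ c) :
    (a + b) ⊓ c ≤ a ⊓ c + b ⊓ c := by
  rw [add_inf, inf_add, inf_add]
  refine le_inf (le_inf inf_le_left ?_) (le_inf ?_ ?_)
  · exact inf_le_right.trans (le_add_of_nonneg_right hb)
  · exact inf_le_right.trans (le_add_of_nonneg_left ha)
  · exact inf_le_right.trans (le_add_of_nonneg_right hc)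

theorem inf_eq_zero_mono {a a' b b' : E} (h : a' ⊓ b' = 0) (ha : 0 ≤ a) (hb : 0 ≤ b)
    (haa : a ≤ a') (hbb : b ≤ b') : a ⊓ b = 0 :=
  le_antisymm ((inf_le_inf haa hbb).trans h.le) (le_inf ha hb)

theorem add_inf_eq_zero {a b c : E} (ha : 0 ≤ a) (hb : 0 ≤ b) (hc : 0 ≤ c)
    (hac : a ⊓ c = 0) (hbc : b ⊓ c = 0) : (a + b) ⊓ c = 0 :=
  le_antisymm ((add_inf_le_inf_add_inf ha hb hc).trans (by simp [hac, hbc]))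
    (le_inf (add_nonneg ha hb) hc)

theorem add_le_of_inf_eq_zero {a b v : E} (h : a ⊓ b = 0) (ha : a ≤ v) (hb : b ≤ v) :
    a + b ≤ v := by
  rw [← inf_add_sup, h, zero_add]
  exact sup_le ha hb

theorem sum_inf_eq_zero {ι : Type*} (s : Finset ι) (z : ι → E) (c : E)
    (hz : ∀ i ∈ s, 0 ≤ z i) (hc : 0 ≤ c) (h : ∀ i ∈ s, z i ⊓ c = 0) : (∑ i ∈ s, z i) ⊓ c = 0 := by
  classical
  induction s using Finset.induction_on with
  | empty => simp [hc]
  | insert i s hi ih =>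
    rw [Finset.sum_insert hi]
    simp only [Finset.mem_insert, forall_eq_or_imp] at hz h
    exact add_inf_eq_zero hz.1 (Finset.sum_nonneg hz.2) hc h.1 (ih hz.2 h.2)

theorem sum_le_of_pairwise_inf_eq_zero {ι : Type*} (s : Finset ι) (z : ι → E) (v : E)
    (hv : 0 ≤ v) (hz : ∀ i ∈ s, 0 ≤ z i) (hzv : ∀ i ∈ s, z i ≤ v)
    (h : ∀ i ∈ s, ∀ j ∈ s, i ≠ j → z i ⊓ z j = 0) : ∑ i ∈ s, z i ≤ v := by
  classical
  induction s using Finset.induction_on with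
  | empty => simpa
  | insert i s hi ih =>
    rw [Finset.sum_insert hi]
    simp only [Finset.mem_insert, forall_eq_or_imp] at hz hzv h
    refine add_le_of_inf_eq_zero ?_ hzv.1 (ih hz.2 hzv.2 fun a ha b hb => (h.2 a ha).2 b hb)
    rw [inf_comm]
    refine sum_inf_eq_zero s z _ hz.2 hz.1 fun j hj => ?_
    exact (h.2 j hj).1 (fun e => hi (e ▸ hj))

theorem abs_sum_le_sum_abs' {ι : Type*} (s : Finset ι) (z : ι → E) :
    |∑ i ∈ s, z i| ≤ ∑ i ∈ s, |z i| := by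
  classical
  induction s using Finset.induction_on with
  | empty => simp
  | insert i s hi ih =>
    rw [Finset.sum_insert hi, Finset.sum_insert hi]
    exact (abs_add_le _ _).trans (by gcongr)

/-- Riesz decomposition for a dominated element. -/
theorem exists_add_eq_of_abs_le_add {z a b : E} (ha : 0 ≤ a) (hb : 0 ≤ b) (h : |z| ≤ a + b) :
    ∃ z₁ z₂, z = z₁ + z₂ ∧ |z₁| ≤ a ∧ |z₂| ≤ b := by
  have h1 : z ≤ a + b := (le_abs_self z).trans h
  have h2 : -z ≤ a + b := (neg_le_abs z).trans h
  -- The first summand is `z` clipped to the order interval from `-a` to `a`.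
  refine ⟨(z ⊓ a) ⊔ (-a), z - ((z ⊓ a) ⊔ (-a)), by abel, ?_, ?_⟩
  · refine abs_le'.2 ⟨sup_le inf_le_right ((neg_nonpos.2 ha).trans ha), ?_⟩
    rw [neg_le]
    exact le_sup_right
  · refine abs_le'.2 ⟨?_, ?_⟩
    · rw [sub_le_comm]
      refine le_trans (le_inf ?_ ?_) le_sup_left
      · exact sub_le_self _ hb
      · rwa [sub_le_iff_le_add]
    · rw [neg_sub, sub_le_iff_le_add]
      refine sup_le (inf_le_left.trans (le_add_of_nonneg_left hb)) ?_
      calc -a = b - (a + b) := by abel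
        _ ≤ b - -z := by gcongr
        _ = b + z := by abel

/-- Truncation of `x` at the level `u`. -/
theorem exists_truncation {x u : E} (hu : 0 ≤ u) : ∃ y, |y| ≤ u ∧ |x - y| ≤ (|x| - u)⁺ := by
  obtain ⟨z₁, z₂, h, h1, h2⟩ := exists_add_eq_of_abs_le_add (z := x) hu
    (posPart_nonneg (|x| - u)) (by rw [← sub_le_iff_le_add']; exact le_posPart _)
  refine ⟨z₁, h1, ?_⟩
  rwa [sub_eq_of_eq_add' h]

end LatticeGroup

/-! ### Scalar multiplication in vector lattices. -/

section LatticeModule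

variable {E : Type*} [AddCommGroup E] [Lattice E] [IsOrderedAddMonoid E] [Module ℝ E]
  [IsOrderedModule ℝ E]

theorem smul_inf_of_nonneg {c : ℝ} (hc : 0 ≤ c) (a b : E) : c • (a ⊓ b) = c • a ⊓ c • b := by
  rcases hc.eq_or_lt with rfl | hc
  · simp
  refine le_antisymm (le_inf (smul_le_smul_of_nonneg_left inf_le_left hc.le)
    (smul_le_smul_of_nonneg_left inf_le_right hc.le)) ?_
  have hi : 0 ≤ c⁻¹ := (inv_pos.2 hc).le
  have : c⁻¹ • (c • a ⊓ c • b) ≤ a ⊓ b := by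
    refine le_inf ?_ ?_
    · simpa [smul_smul, inv_mul_cancel₀ hc.ne'] using
        smul_le_smul_of_nonneg_left (inf_le_left : c • a ⊓ c • b ≤ _) hi
    · simpa [smul_smul, inv_mul_cancel₀ hc.ne'] using
        smul_le_smul_of_nonneg_left (inf_le_right : c • a ⊓ c • b ≤ _) hi
  simpa [smul_smul, mul_inv_cancel₀ hc.ne'] using smul_le_smul_of_nonneg_left this hc.le

/-- Additivity of disjointness gives natural multiples, and a real multiple is dominated by a
natural one. -/
theorem smul_inf_eq_zero {c : ℝ} (hc : 0 ≤ c) {a b : E} (ha : 0 ≤ a) (hb : 0 ≤ b)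
    (h : a ⊓ b = 0) : (c • a) ⊓ b = 0 := by
  have h0 : ∀ n : ℕ, (n : ℝ) • a ⊓ b = 0 := fun n => by
    induction n with
    | zero => simpa using hb
    | succ n ih =>
      push_cast
      rw [add_smul, one_smul]
      exact add_inf_eq_zero (smul_nonneg n.cast_nonneg ha) ha hb ih h
  obtain ⟨n, hn⟩ := exists_nat_ge c
  exact inf_eq_zero_mono (h0 n) (smul_nonneg hc ha) hb (smul_le_smul_of_nonneg_right hn ha) le_rfl

theorem abs_real_smul (c : ℝ) (x : E) : |c • x| = |c| • |x| := by
  have key : ∀ {c : ℝ}, 0 ≤ c → |c • x| = c • |x| := fun {c} hc => by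
    rcases hc.eq_or_lt with rfl | hc
    · simp
    have h : ∀ {d : ℝ}, 0 < d → ∀ y : E, |d • y| ≤ d • |y| := fun {d} hd y =>
      abs_le'.2 ⟨smul_le_smul_of_nonneg_left (le_abs_self y) hd.le, by
        rw [← smul_neg]; exact smul_le_smul_of_nonneg_left (neg_le_abs y) hd.le⟩
    refine le_antisymm (h hc x) ?_
    have := smul_le_smul_of_nonneg_left (h (inv_pos.2 hc) (c • x)) hc.le
    simpa [smul_smul, inv_mul_cancel₀ hc.ne', mul_inv_cancel₀ hc.ne'] using this
  rcases le_total 0 c with hc | hc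
  · rw [key hc, abs_of_nonneg hc]
  · rw [abs_of_nonpos hc, ← key (neg_nonneg.2 hc), neg_smul, abs_neg]

end LatticeModule

section NormedLattice

variable {E : Type*} [NormedAddCommGroup E] [Lattice E] [IsOrderedAddMonoid E] [HasSolidNorm E]

theorem norm_le_norm_of_nonneg_of_le {a b : E} (ha : 0 ≤ a) (hab : a ≤ b) : ‖a‖ ≤ ‖b‖ :=
  norm_le_norm_of_abs_le_abs (abs_le_abs_of_nonneg ha hab)

theorem norm_le_norm_of_abs_le {a b : E} (hab : |a| ≤ b) : ‖a‖ ≤ ‖b‖ := by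
  rw [← norm_abs_eq_norm a]
  exact norm_le_norm_of_nonneg_of_le (abs_nonneg a) hab

end NormedLattice

/-- A sublinear function dominates a linear functional that touches it at a given point. -/
theorem exists_linearMap_le_sublinear_eq {V : Type*} [AddCommGroup V] [Module ℝ V] (N : V → ℝ)
    (hsmul : ∀ c : ℝ, 0 < c → ∀ x, N (c • x) = c * N x)
    (hadd : ∀ x y, N (x + y) ≤ N x + N y) (x : V) :
    ∃ f : V →ₗ[ℝ] ℝ, (∀ y, f y ≤ N y) ∧ f x = N x := by
  have h0 : N 0 = 0 := by
    have := hsmul 2 two_pos 0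
    rw [smul_zero] at this
    linarith
  have hneg : ∀ y, 0 ≤ N y + N (-y) := fun y => by
    have := hadd y (-y)
    rwa [add_neg_cancel, h0] at this
  by_cases hx : x = 0
  · obtain ⟨f, -, hf⟩ := exists_extension_of_le_sublinear (⟨⊥, 0⟩ : V →ₗ.[ℝ] ℝ) N hsmul hadd
      (by rintro ⟨y, hy⟩; rw [Submodule.mem_bot] at hy; simp [hy, h0])
    exact ⟨f, hf, by simp [hx, h0]⟩
  · obtain ⟨f, hfx, hf⟩ := exists_extension_of_le_sublinear
      (LinearPMap.mkSpanSingleton x (N x) hx) N hsmul hadd (by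
        rintro ⟨y, hy⟩
        obtain ⟨c, rfl⟩ := Submodule.mem_span_singleton.1 hy
        rw [LinearPMap.mkSpanSingleton'_apply, smul_eq_mul]
        rcases lt_trichotomy c 0 with hc | rfl | hc
        -- On the negative ray, the bound comes from `0 ≤ N y + N (-y)`.
        · have h1 := hsmul (-c) (neg_pos.2 hc) x
          have h2 := hneg (c • x)
          rw [← neg_smul, h1] at h2
          simp only [RingHom.id_apply]
          linarith
        · simp [h0]
        · exact (hsmul c hc x).ge)
    refine ⟨f, hf, ?_⟩
    have := hfx ⟨x, Submodule.mem_span_singleton_self x⟩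
    rw [this]
    exact LinearPMap.mkSpanSingleton_apply ℝ ℝ hx (N x)

theorem Seminorm.exists_linearMap_abs_le_eq {V : Type*} [AddCommGroup V] [Module ℝ V]
    (p : Seminorm ℝ V) (x : V) : ∃ f : V →ₗ[ℝ] ℝ, (∀ y, |f y| ≤ p y) ∧ f x = p x := by
  obtain ⟨f, hf, hx⟩ := exists_linearMap_le_sublinear_eq p
    (fun c hc x => by rw [map_smul_eq_mul, Real.norm_of_nonneg hc.le]) (map_add_le_add p) x
  refine ⟨f, fun y => abs_le'.2 ⟨hf y, ?_⟩, hx⟩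
  have := hf (-y)
  rwa [map_neg, map_neg_eq_map] at this

/-! ### Lattice seminorms and their restriction to principal bands. -/

section SolidSeminorm

variable {E : Type*} [AddCommGroup E] [Lattice E] [IsOrderedAddMonoid E] [Module ℝ E]
  [IsOrderedModule ℝ E]

/-- A lattice seminorm: a seminorm that is monotone with respect to absolute values. -/
def Seminorm.IsSolid (p : Seminorm ℝ E) : Prop := ∀ ⦃a b : E⦄, |a| ≤ |b| → p a ≤ p b

variable {p : Seminorm ℝ E}

theorem Seminorm.IsSolid.mono (hp : p.IsSolid) {a b : E} (ha : 0 ≤ a) (hab : a ≤ b) :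
    p a ≤ p b := hp (abs_le_abs_of_nonneg ha hab)

theorem Seminorm.IsSolid.abs_eq (hp : p.IsSolid) (a : E) : p |a| = p a :=
  le_antisymm (hp (abs_abs a).le) (hp (abs_abs a).ge)

theorem abs_inf_smul_nonneg (x e : E) {t : ℝ} (ht : 0 ≤ t) : 0 ≤ |x| ⊓ t • |e| :=
  le_inf (abs_nonneg x) (smul_nonneg ht (abs_nonneg e))

theorem bddAbove_range_bandSeminorm (hp : p.IsSolid) (e x : E) :
    BddAbove (Set.range fun m : ℕ => p (|x| ⊓ (m : ℝ) • |e|)) := by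
  refine ⟨p x, ?_⟩
  rintro _ ⟨m, rfl⟩
  rw [← hp.abs_eq x]
  exact hp.mono (abs_inf_smul_nonneg x e m.cast_nonneg) inf_le_left

theorem le_iSup_bandSeminorm (hp : p.IsSolid) (e x : E) {t : ℝ} (ht : 0 ≤ t) :
    p (|x| ⊓ t • |e|) ≤ ⨆ m : ℕ, p (|x| ⊓ (m : ℝ) • |e|) := by
  obtain ⟨m, hm⟩ := exists_nat_ge t
  exact (hp.mono (abs_inf_smul_nonneg x e ht) (inf_le_inf_left _
    (smul_le_smul_of_nonneg_right hm (abs_nonneg e)))).trans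
    (le_ciSup (bddAbove_range_bandSeminorm hp e x) m)

/-- The part of a lattice seminorm carried by the band generated by `e`. -/
noncomputable def bandSeminorm (p : Seminorm ℝ E) (hp : p.IsSolid) (e : E) : Seminorm ℝ E :=
  Seminorm.ofSMulLE (fun x => ⨆ m : ℕ, p (|x| ⊓ (m : ℝ) • |e|))
    (by
      have : ∀ m : ℕ, |(0 : E)| ⊓ (m : ℝ) • |e| = 0 := fun m => by
        rw [abs_zero]; exact inf_eq_left.2 (smul_nonneg m.cast_nonneg (abs_nonneg e))
      simp only [this, map_zero, ciSup_const])
    (fun x y => ciSup_le fun m => by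
      refine le_trans ?_ (add_le_add (le_iSup_bandSeminorm hp e x m.cast_nonneg)
        (le_iSup_bandSeminorm hp e y m.cast_nonneg))
      refine le_trans (hp.mono (abs_inf_smul_nonneg _ _ m.cast_nonneg) ?_) (map_add_le_add p _ _)
      exact (inf_le_inf_right _ (abs_add_le x y)).trans (add_inf_le_inf_add_inf (abs_nonneg x)
        (abs_nonneg y) (smul_nonneg m.cast_nonneg (abs_nonneg e))))
    (fun c x => by
      rcases eq_or_ne c 0 with rfl | hc
      · have : ∀ m : ℕ, |(0 : E)| ⊓ (m : ℝ) • |e| = 0 := fun m => by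
          rw [abs_zero]; exact inf_eq_left.2 (smul_nonneg m.cast_nonneg (abs_nonneg e))
        simp only [zero_smul, this, map_zero, ciSup_const, norm_zero, zero_mul, le_refl]
      · refine ciSup_le fun m => ?_
        have hc' : 0 < |c| := abs_pos.2 hc
        have : |c • x| ⊓ (m : ℝ) • |e| = |c| • (|x| ⊓ ((m : ℝ) / |c|) • |e|) := by
          rw [abs_real_smul, smul_inf_of_nonneg hc'.le, smul_smul, mul_div_cancel₀ _ hc'.ne']
        rw [this, map_smul_eq_mul, Real.norm_eq_abs, Real.norm_eq_abs, abs_abs]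
        gcongr
        exact le_iSup_bandSeminorm hp e x (div_nonneg m.cast_nonneg hc'.le))

variable (hp : p.IsSolid)

theorem bandSeminorm_apply (e x : E) :
    bandSeminorm p hp e x = ⨆ m : ℕ, p (|x| ⊓ (m : ℝ) • |e|) := rfl

theorem bandSeminorm_isSolid (e : E) : (bandSeminorm p hp e).IsSolid := fun _ b hab =>
  ciSup_le fun m => (hp.mono (abs_inf_smul_nonneg _ _ m.cast_nonneg)
    (inf_le_inf_right _ hab)).trans (le_ciSup (bddAbove_range_bandSeminorm hp e b) m)

theorem bandSeminorm_le (e x : E) : bandSeminorm p hp e x ≤ p x :=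
  ciSup_le fun m => by
    rw [← hp.abs_eq x]
    exact hp.mono (abs_inf_smul_nonneg x e m.cast_nonneg) inf_le_left

theorem bandSeminorm_eq_of_abs_le {e x : E} (h : |x| ≤ |e|) : bandSeminorm p hp e x = p x := by
  refine le_antisymm (bandSeminorm_le hp e x) ?_
  have := le_iSup_bandSeminorm hp e x zero_le_one
  rwa [one_smul, inf_eq_left.2 h, hp.abs_eq] at this

/-- A functional dominated by the band seminorm therefore vanishes on everything disjoint from `e`.
Hahn–Banach functionals of this kind replace band projections, which need not exist. -/
theorem bandSeminorm_eq_zero_of_disjoint {e x : E} (h : |x| ⊓ |e| = 0) :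
    bandSeminorm p hp e x = 0 := by
  have : ∀ m : ℕ, |x| ⊓ (m : ℝ) • |e| = 0 := fun m => by
    rw [inf_comm]
    exact smul_inf_eq_zero m.cast_nonneg (abs_nonneg e) (abs_nonneg x) (by rwa [inf_comm])
  simp [bandSeminorm_apply, this]

theorem exists_bandSeminorm_lt (e x : E) {ε : ℝ} (hε : 0 < ε) :
    ∃ m : ℕ, bandSeminorm p hp e x < p (|x| ⊓ (m : ℝ) • |e|) + ε := by
  obtain ⟨m, hm⟩ := exists_lt_of_lt_ciSup
    (f := fun m : ℕ => p (|x| ⊓ (m : ℝ) • |e|)) (b := bandSeminorm p hp e x - ε)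
    (by rw [bandSeminorm_apply]; linarith)
  exact ⟨m, by linarith⟩

end SolidSeminorm

/-! ### The variation of a functional. -/

section NormedLattice

variable {E : Type*} [NormedAddCommGroup E] [NormedSpace ℝ E] [Lattice E] [IsOrderedAddMonoid E]
  [IsOrderedModule ℝ E] [HasSolidNorm E]

theorem normSeminorm_isSolid : (normSeminorm ℝ E).IsSolid := fun _ _ h =>
  norm_le_norm_of_abs_le_abs h

theorem norm_apply_le_of_abs_le (ψ : StrongDual ℝ E) {z x : E} (h : |z| ≤ |x|) :
    |ψ z| ≤ ‖ψ‖ * ‖x‖ :=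
  (ψ.le_opNorm z).trans (by gcongr; exact norm_le_norm_of_abs_le_abs h)

theorem bddAbove_range_variation (ψ : StrongDual ℝ E) (x : E) :
    BddAbove (Set.range fun z : {z : E // |z| ≤ |x|} => |ψ z|) := by
  refine ⟨‖ψ‖ * ‖x‖, ?_⟩
  rintro _ ⟨z, rfl⟩
  exact norm_apply_le_of_abs_le ψ z.2

instance nonempty_abs_le (x : E) : Nonempty {z : E // |z| ≤ |x|} := ⟨⟨x, le_rfl⟩⟩

/-- The lattice seminorm `x ↦ |ψ|(|x|)` of a functional `ψ`. -/
noncomputable def variationSeminorm (ψ : StrongDual ℝ E) : Seminorm ℝ E :=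
  Seminorm.ofSMulLE (fun x => ⨆ z : {z : E // |z| ≤ |x|}, |ψ z|)
    (by
      refine le_antisymm (ciSup_le ?_) (Real.iSup_nonneg fun _ => abs_nonneg _)
      rintro ⟨z, hz⟩
      have := norm_apply_le_of_abs_le ψ hz
      simpa using this)
    (fun x y => ciSup_le fun z => by
      -- Riesz decomposition splits a test vector for `x + y` into test vectors for `x` and for `y`.
      obtain ⟨z₁, z₂, h, h1, h2⟩ := exists_add_eq_of_abs_le_add (abs_nonneg x) (abs_nonneg y)
        (z.2.trans (abs_add_le x y))
      rw [h, map_add]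
      exact (abs_add_le _ _).trans (add_le_add
        (le_ciSup (bddAbove_range_variation ψ x) ⟨z₁, h1⟩)
        (le_ciSup (bddAbove_range_variation ψ y) ⟨z₂, h2⟩)))
    (fun c x => ciSup_le fun z => by
      rcases eq_or_ne c 0 with rfl | hc
      · have := norm_apply_le_of_abs_le ψ z.2
        simpa using this
      · have hz : |c⁻¹ • (z : E)| ≤ |x| := by
          have := smul_le_smul_of_nonneg_left z.2 (abs_nonneg c⁻¹)
          rwa [← abs_real_smul, ← abs_real_smul, smul_smul, inv_mul_cancel₀ hc, one_smul] at this
        have h := le_ciSup (bddAbove_range_variation ψ x) ⟨_, hz⟩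
        have h2 : |ψ z| = ‖c‖ * |ψ (c⁻¹ • (z : E))| := by
          rw [map_smul, smul_eq_mul, abs_mul, ← mul_assoc, Real.norm_eq_abs, ← abs_mul,
            mul_inv_cancel₀ hc, abs_one, one_mul]
        rw [h2]
        gcongr)

theorem le_variationSeminorm (ψ : StrongDual ℝ E) {z x : E} (h : |z| ≤ |x|) :
    |ψ z| ≤ variationSeminorm ψ x :=
  le_ciSup (bddAbove_range_variation ψ x) ⟨z, h⟩

theorem variationSeminorm_isSolid (ψ : StrongDual ℝ E) : (variationSeminorm ψ).IsSolid :=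
  fun _ _ hab => ciSup_le fun z => le_variationSeminorm ψ (z.2.trans hab)

theorem variationSeminorm_le (ψ : StrongDual ℝ E) (x : E) :
    variationSeminorm ψ x ≤ ‖ψ‖ * ‖x‖ :=
  ciSup_le fun z => norm_apply_le_of_abs_le ψ z.2

theorem exists_variationSeminorm_lt (ψ : StrongDual ℝ E) (x : E) {ε : ℝ} (hε : 0 < ε) :
    ∃ z, |z| ≤ |x| ∧ variationSeminorm ψ x < ψ z + ε := by
  obtain ⟨⟨z, hz⟩, h⟩ := exists_lt_of_lt_ciSup
    (f := fun z : {z : E // |z| ≤ |x|} => |ψ z|) (b := variationSeminorm ψ x - ε)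
    (by change _ < variationSeminorm ψ x; linarith)
  rcases abs_choice (ψ z) with h' | h'
  · exact ⟨z, hz, by rw [← h']; simp only at h; linarith⟩
  · exact ⟨-z, by rwa [abs_neg], by rw [map_neg, ← h']; simp only at h; linarith⟩

end NormedLattice

/-! ### Weak and weak-star null sequences, and a gliding hump. -/

section Weak

variable {X : Type*} [NormedAddCommGroup X] [NormedSpace ℝ X]

theorem weaklyNull_iff {x : ℕ → X} :
    WeaklyNull x ↔ ∀ ψ : StrongDual ℝ X, Tendsto (fun n => ψ (x n)) atTop (𝓝 0) := by
  have hinj : Function.Injective (topDualPairing ℝ X).flip := by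
    intro a b hab
    by_contra hne
    obtain ⟨f, -, hf⟩ := exists_dual_vector ℝ (a - b) (norm_ne_zero_iff.2 (sub_ne_zero.2 hne))
    have : f a = f b := LinearMap.congr_fun hab f
    rw [map_sub, this, sub_self] at hf
    have h := norm_ne_zero_iff.2 (sub_ne_zero.2 hne)
    exact h (by simpa using hf.symm)
  refine (WeakBilin.tendsto_iff_forall_eval_tendsto (B := (topDualPairing ℝ X).flip)
    (f := fun n => toWeakSpace ℝ X (x n)) (x := 0) hinj).trans ?_
  refine forall_congr' fun ψ => ?_
  have h0 : ((topDualPairing ℝ X).flip 0) ψ = 0 := map_zero ψ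
  exact Iff.of_eq (congrArg (fun t => Tendsto (fun n => ψ (x n)) atTop (𝓝 t)) h0)

theorem weakStarNull_iff {f : ℕ → StrongDual ℝ X} :
    WeakStarNull f ↔ ∀ x, Tendsto (fun n => f n x) atTop (𝓝 0) := by
  refine (tendsto_iff_forall_eval_tendsto_topDualPairing
    (f := fun n => StrongDual.toWeakDual (f n)) (x := 0)).trans ?_
  refine forall_congr' fun x => ?_
  have h0 : topDualPairing ℝ X 0 x = 0 := rfl
  exact Iff.of_eq (congrArg (fun t => Tendsto (fun n => f n x) atTop (𝓝 t)) h0)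

theorem WeaklyNull.comp {x : ℕ → X} (hx : WeaklyNull x) {φ : ℕ → ℕ} (hφ : Tendsto φ atTop atTop) :
    WeaklyNull (x ∘ φ) :=
  weaklyNull_iff.2 fun ψ => (weaklyNull_iff.1 hx ψ).comp hφ

/-- A sequence of reals that is not null is bounded away from zero along a subsequence. -/
theorem exists_subseq_of_not_tendsto_zero {a : ℕ → ℝ} (h : ¬ Tendsto a atTop (𝓝 0)) :
    ∃ ε > 0, ∃ φ : ℕ → ℕ, StrictMono φ ∧ ∀ n, ε ≤ |a (φ n)| := by
  rw [Metric.tendsto_atTop] at h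
  push Not at h
  obtain ⟨ε, hε, h⟩ := h
  have hf : ∃ᶠ n in atTop, ε ≤ |a n| := frequently_atTop.2 fun N => by
    obtain ⟨n, hn, h⟩ := h N
    exact ⟨n, hn, by simpa using h⟩
  obtain ⟨φ, hφ, h⟩ := extraction_of_frequently_atTop hf
  exact ⟨ε, hε, φ, hφ, h⟩

/-- On a weakly null sequence, a weakly unconditionally summable sequence of functionals tends to
zero along the diagonal. -/
theorem tendsto_diagonal_of_sum_abs_le [CompleteSpace X] {g : ℕ → StrongDual ℝ X} {C : ℝ}
    (hg : ∀ (s : Finset ℕ) (y : X), ∑ k ∈ s, |g k y| ≤ C * ‖y‖) {x : ℕ → X} (hx : WeaklyNull x) :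
    Tendsto (fun n => g n (x n)) atTop (𝓝 0) := by
  by_contra hcon
  obtain ⟨ε, hε, φ, hφ, hφε⟩ := exists_subseq_of_not_tendsto_zero hcon
  have hsum : ∀ y, Summable fun i => |g i y| := fun y =>
    summable_of_sum_le (fun _ => abs_nonneg _) (fun s => hg s y)
  -- Gliding hump: the functionals up to `a` are small on `x b`, those from `b` on are small on `x
  -- a`, and the diagonal term at `b` stays large.
  have hstep : ∀ a : ℕ, ∃ b, a < b ∧ (∑ i ∈ Finset.range (a + 1), |g i (x b)| ≤ ε / 4) ∧
      (∀ s : Finset ℕ, (∀ i ∈ s, b ≤ i) → ∑ i ∈ s, |g i (x a)| ≤ ε / 4) ∧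
      ε ≤ |g b (x b)| := by
    intro a
    have h1 : Tendsto (fun b => ∑ i ∈ Finset.range (a + 1), |g i (x b)|) atTop (𝓝 0) := by
      rw [← Finset.sum_const_zero (s := Finset.range (a + 1))]
      exact tendsto_finsetSum _ fun i _ => by simpa using (weaklyNull_iff.1 hx (g i)).abs
    obtain ⟨N1, hN1⟩ := eventually_atTop.1 (h1.eventually (gt_mem_nhds (by positivity : 0 < ε / 4)))
    obtain ⟨s0, hs0⟩ := (summable_iff_vanishing_norm.1 (hsum (x a))) (ε / 4) (by positivity)
    obtain ⟨N2, hN2⟩ : ∃ N, ∀ i ∈ s0, i < N := ⟨s0.sup id + 1, fun i hi =>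
      Nat.lt_succ_of_le (Finset.le_sup (f := id) hi)⟩
    let n := a + N1 + N2 + 1
    have hn : n ≤ φ n := hφ.id_le n
    refine ⟨φ n, by omega, (hN1 _ (by omega)).le, fun s hs => ?_, hφε n⟩
    have hd : Disjoint s s0 := Finset.disjoint_left.2 fun i hi hi0 => by
      have := hs i hi
      have := hN2 i hi0
      omega
    have := hs0 s hd
    exact (le_abs_self _).trans this.le
  choose F hF1 hF2 hF3 hF4 using hstep
  let k : ℕ → ℕ := fun j => Nat.rec (F 0) (fun _ a => F a) j
  have hk1 : ∀ j, k (j + 1) = F (k j) := fun _ => rfl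
  have hkmono : StrictMono k := strictMono_nat_of_lt_succ fun j => hF1 (k j)
  have hkε : ∀ j, ε ≤ |g (k j) (x (k j))| := fun j => by
    cases j with
    | zero => exact hF4 0
    | succ j => exact hF4 (k j)
  have hsumk : ∀ y, Summable fun j => g (k j) y := fun y =>
    ((hsum y).comp_injective hkmono.injective).of_abs
  have hgk : ∀ (s : Finset ℕ) (y : X), ∑ j ∈ s, |g (k j) y| ≤ C * ‖y‖ := fun s y => by
    have := hg (s.map ⟨k, hkmono.injective⟩) y
    rwa [Finset.sum_map] at this
  -- The sum of the selected functionals is bounded. At `x (k (j + 1))` its head and its tail cost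
  -- at most `ε / 4` each, so at least `ε / 2` remains, against weak nullity.
  let Glin : X →ₗ[ℝ] ℝ :=
    { toFun := fun y => ∑' j, g (k j) y
      map_add' := fun y z => by
        simp only [map_add]
        exact (hsumk y).tsum_add (hsumk z)
      map_smul' := fun c y => by
        simp only [map_smul, smul_eq_mul, RingHom.id_apply]
        exact tsum_mul_left }
  have hGb : ∀ y, |Glin y| ≤ C * ‖y‖ := fun y => by
    have ht := (hsumk y).hasSum.tendsto_sum_nat.abs
    exact le_of_tendsto ht (Eventually.of_forall fun N =>
      (Finset.abs_sum_le_sum_abs _ _).trans (hgk _ y))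
  have hlow : ∀ j, ε / 2 ≤ |Glin (x (k (j + 1)))| := by
    intro j
    have ht := (hsumk (x (k (j + 1)))).hasSum.tendsto_sum_nat.abs
    refine ge_of_tendsto ht (eventually_atTop.2 ⟨j + 2, fun N hN => ?_⟩)
    set y := x (k (j + 1)) with hy
    have hsplit : ∑ i ∈ Finset.range N, g (k i) y = ∑ i ∈ Finset.range (j + 1), g (k i) y +
        (g (k (j + 1)) y + ∑ i ∈ Finset.Ico (j + 2) N, g (k i) y) := by
      rw [← Finset.sum_range_add_sum_Ico (fun i => g (k i) y) (show j + 1 ≤ N by omega),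
        Finset.sum_eq_sum_Ico_succ_bot (show j + 1 < N by omega)]
    have hA : |∑ i ∈ Finset.range (j + 1), g (k i) y| ≤ ε / 4 := by
      refine (Finset.abs_sum_le_sum_abs _ _).trans (le_trans ?_ (hF2 (k j)))
      rw [← hk1, ← hy]
      refine (Finset.sum_map (Finset.range (j + 1)) ⟨k, hkmono.injective⟩
        (fun i => |g i y|)).ge.trans ?_
      refine Finset.sum_le_sum_of_subset_of_nonneg ?_ fun _ _ _ => abs_nonneg _
      intro i hi
      obtain ⟨l, hl, rfl⟩ := Finset.mem_map.1 hi
      have h2 : l ≤ j := by simpa [Nat.lt_succ_iff] using hl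
      exact Finset.mem_range.2 (Nat.lt_succ_of_le (hkmono.monotone h2))
    have hB : |∑ i ∈ Finset.Ico (j + 2) N, g (k i) y| ≤ ε / 4 := by
      refine (Finset.abs_sum_le_sum_abs _ _).trans ?_
      have := hF3 (k (j + 1)) ((Finset.Ico (j + 2) N).map ⟨k, hkmono.injective⟩) (by
        intro i hi
        obtain ⟨l, hl, rfl⟩ := Finset.mem_map.1 hi
        exact hkmono.monotone (Finset.mem_Ico.1 hl).1)
      rwa [Finset.sum_map] at this
    rw [hsplit]
    have h3 := hkε (j + 1)
    rw [← hy] at h3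
    have h4 := abs_sub_abs_le_abs_sub (g (k (j + 1)) y)
      (-(∑ i ∈ Finset.range (j + 1), g (k i) y + ∑ i ∈ Finset.Ico (j + 2) N, g (k i) y))
    rw [abs_neg] at h4
    have h5 := abs_add_le (∑ i ∈ Finset.range (j + 1), g (k i) y)
      (∑ i ∈ Finset.Ico (j + 2) N, g (k i) y)
    have h6 : ∑ i ∈ Finset.range (j + 1), g (k i) y +
        (g (k (j + 1)) y + ∑ i ∈ Finset.Ico (j + 2) N, g (k i) y) = g (k (j + 1)) y -
        -(∑ i ∈ Finset.range (j + 1), g (k i) y + ∑ i ∈ Finset.Ico (j + 2) N, g (k i) y) := by ring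
    rw [h6]
    linarith
  have hlim := (weaklyNull_iff.1 hx (Glin.mkContinuous C hGb)).comp
    (hkmono.tendsto_atTop.comp (tendsto_add_atTop_nat 1))
  have hlim := hlim.abs
  rw [abs_zero] at hlim
  have := ge_of_tendsto hlim (Eventually.of_forall hlow)
  linarith

end Weak

/-! ### Disjoint sequences and almost order bounded sets. -/

section Disjoint

variable {E : Type*} [NormedAddCommGroup E] [NormedSpace ℝ E] [Lattice E] [IsOrderedAddMonoid E]
  [IsOrderedModule ℝ E] [HasSolidNorm E]

theorem IsDisjointSeq.comp {y : ℕ → E} (hy : IsDisjointSeq y) {φ : ℕ → ℕ}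
    (hφ : Function.Injective φ) : IsDisjointSeq (y ∘ φ) :=
  fun _ _ hmn => hy _ _ (hφ.ne hmn)

/-- Moving the signs of `ψ (z i)` onto the vectors turns the sum into a single value of `ψ` at a
vector dominated by `v`. -/
theorem sum_abs_apply_le_of_sum_abs_le {ι : Type*} (ψ : StrongDual ℝ E) (s : Finset ι)
    (z : ι → E) (v : E) (h : ∑ i ∈ s, |z i| ≤ v) : ∑ i ∈ s, |ψ (z i)| ≤ ‖ψ‖ * ‖v‖ := by
  have hσ : ∀ i, ∃ c : ℝ, |c| = 1 ∧ |ψ (z i)| = c * ψ (z i) := fun i => by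
    rcases abs_choice (ψ (z i)) with h | h
    · exact ⟨1, by simp, by rw [h, one_mul]⟩
    · exact ⟨-1, by simp, by rw [h, neg_one_mul]⟩
  choose c hc1 hc2 using hσ
  have h1 : ∑ i ∈ s, |ψ (z i)| = ψ (∑ i ∈ s, c i • z i) := by
    simp only [map_sum, map_smul, smul_eq_mul, hc2]
  have h2 : |∑ i ∈ s, c i • z i| ≤ v := by
    refine (abs_sum_le_sum_abs' s _).trans (le_trans (le_of_eq ?_) h)
    exact Finset.sum_congr rfl fun i _ => by rw [abs_real_smul, hc1, one_smul]
  rw [h1]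
  calc ψ (∑ i ∈ s, c i • z i) ≤ ‖ψ‖ * ‖∑ i ∈ s, c i • z i‖ :=
        (le_abs_self _).trans (ψ.le_opNorm _)
    _ ≤ ‖ψ‖ * ‖v‖ := by gcongr; exact norm_le_norm_of_abs_le h2

theorem sum_abs_apply_le_of_disjoint {ι : Type*} (ψ : StrongDual ℝ E) (s : Finset ι) (z : ι → E)
    (v : E) (hv : 0 ≤ v) (hzv : ∀ i ∈ s, |z i| ≤ v)
    (h : ∀ i ∈ s, ∀ j ∈ s, i ≠ j → |z i| ⊓ |z j| = 0) :
    ∑ i ∈ s, |ψ (z i)| ≤ ‖ψ‖ * ‖v‖ :=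
  sum_abs_apply_le_of_sum_abs_le ψ s z v
    (sum_le_of_pairwise_inf_eq_zero s _ v hv (fun _ _ => abs_nonneg _) hzv h)

/-- Order bounded disjoint sequences are weakly null. -/
theorem IsDisjointSeq.weaklyNull_of_abs_le {y : ℕ → E} (hy : IsDisjointSeq y) {u : E}
    (hu : ∀ n, |y n| ≤ u) : WeaklyNull y := by
  refine weaklyNull_iff.2 fun ψ => ?_
  have hu0 : 0 ≤ u := (abs_nonneg _).trans (hu 0)
  have : Summable fun n => |ψ (y n)| := summable_of_sum_le (fun _ => abs_nonneg _) fun s =>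
    sum_abs_apply_le_of_disjoint ψ s y u hu0 (fun i _ => hu i) fun i _ j _ hij => hy i j hij
  exact this.of_abs.tendsto_atTop_zero

/-- The parts of the variation of `ψ` in disjoint bands add up to at most the whole. Near-optimal
test vectors `z k` below `|y| ⊓ m_k |e k|` are disjoint and dominated by `|y|`, so their sum can be
tested against `ψ`. -/
theorem sum_bandSeminorm_variation_le (ψ : StrongDual ℝ E) {e : ℕ → E} (he : IsDisjointSeq e)
    (s : Finset ℕ) (y : E) :
    ∑ k ∈ s, bandSeminorm _ (variationSeminorm_isSolid ψ) (e k) y ≤ ‖ψ‖ * ‖y‖ := by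
  refine le_of_forall_pos_le_add fun ε hε => ?_
  set η : ℝ := ε / (2 * (s.card + 1)) with hη
  have hη0 : 0 < η := by positivity
  -- Each term is approximated twice, in the level `m k` and in the vector `z k`, hence the factor 2
  -- in `η`.
  choose m hm using fun k => exists_bandSeminorm_lt (variationSeminorm_isSolid ψ) (e k) y hη0
  choose z hz1 hz2 using fun k =>
    exists_variationSeminorm_lt ψ (|y| ⊓ (m k : ℝ) • |e k|) hη0
  have habs : ∀ k, |(|y| ⊓ (m k : ℝ) • |e k|)| = |y| ⊓ (m k : ℝ) • |e k| := fun k =>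
    abs_of_nonneg (abs_inf_smul_nonneg y (e k) (m k).cast_nonneg)
  simp only [habs] at hz1
  have h1 : ∑ k ∈ s, |ψ (z k)| ≤ ‖ψ‖ * ‖(|y|)‖ := by
    refine sum_abs_apply_le_of_disjoint ψ s z |y| (abs_nonneg y)
      (fun i _ => (hz1 i).trans inf_le_left) fun i _ j _ hij => ?_
    refine inf_eq_zero_mono ?_ (abs_nonneg _) (abs_nonneg _) ((hz1 i).trans inf_le_right)
      ((hz1 j).trans inf_le_right)
    refine smul_inf_eq_zero (m i).cast_nonneg (abs_nonneg _)
      (smul_nonneg (m j).cast_nonneg (abs_nonneg _)) ?_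
    rw [inf_comm]
    exact smul_inf_eq_zero (m j).cast_nonneg (abs_nonneg _) (abs_nonneg _) (he j i hij.symm)
  rw [norm_abs_eq_norm] at h1
  have h2 : ∑ k ∈ s, bandSeminorm _ (variationSeminorm_isSolid ψ) (e k) y ≤
      ∑ k ∈ s, (|ψ (z k)| + 2 * η) := Finset.sum_le_sum fun k _ => by
    have := hm k
    have := hz2 k
    have := le_abs_self (ψ (z k))
    linarith
  rw [Finset.sum_add_distrib, Finset.sum_const, nsmul_eq_mul] at h2
  have h3 : (s.card : ℝ) * (2 * η) ≤ ε := by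
    rw [hη, show (s.card : ℝ) * (2 * (ε / (2 * (s.card + 1)))) = ε * (s.card / (s.card + 1)) by
      field_simp]
    exact mul_le_of_le_one_right hε.le ((div_le_one (by positivity)).2 (by linarith))
  linarith

/-- The functionals `g k`, carried by the band of `y k` and dominated by the variation of `ψ`, are
weakly unconditionally summable, so `g k (x k)` tends to 0. But `g k (x k)` is the band seminorm of
`x k`, which dominates `|ψ (y k)|`. -/
theorem WeaklyNull.of_abs_le_of_disjoint [CompleteSpace E] {x y : ℕ → E} (hx : WeaklyNull x)
    (hy : IsDisjointSeq y) (hxy : ∀ n, |y n| ≤ |x n|) : WeaklyNull y := by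
  refine weaklyNull_iff.2 fun ψ => ?_
  choose g hg1 hg2 using fun k => Seminorm.exists_linearMap_abs_le_eq
    (bandSeminorm _ (variationSeminorm_isSolid ψ) (y k)) (x k)
  have hgb : ∀ k z, |g k z| ≤ ‖ψ‖ * ‖z‖ := fun k z =>
    (hg1 k z).trans ((bandSeminorm_le _ _ _).trans (variationSeminorm_le ψ z))
  have := tendsto_diagonal_of_sum_abs_le (g := fun k => (g k).mkContinuous ‖ψ‖ (hgb k))
    (C := ‖ψ‖) (fun s z => (Finset.sum_le_sum fun k _ => hg1 k z).trans
      (sum_bandSeminorm_variation_le ψ hy s z)) hx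
  refine squeeze_zero_norm (fun n => ?_) this
  have h1 : |ψ (y n)| ≤ variationSeminorm ψ (y n) := le_variationSeminorm ψ le_rfl
  have h2 := bandSeminorm_isSolid (variationSeminorm_isSolid ψ) (y n) (hxy n)
  rw [bandSeminorm_eq_of_abs_le _ le_rfl] at h2
  change |ψ (y n)| ≤ g n (x n)
  rw [hg2]
  exact h1.trans h2

/-- Disjoint sequences in the solid hull of a weakly null sequence are weakly null. -/
theorem WeaklyNull.of_mem_solidClosure [CompleteSpace E] {x y : ℕ → E} (hx : WeaklyNull x)
    (hy : IsDisjointSeq y)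
    (hxy : ∀ n, y n ∈ LatticeOrderedAddCommGroup.solidClosure (Set.range x)) : WeaklyNull y := by
  have hn : ∀ k, ∃ n, |y k| ≤ |x n| := fun k => by
    obtain ⟨_, ⟨n, rfl⟩, h⟩ := hxy k
    exact ⟨n, h⟩
  choose n hn using hn
  refine weaklyNull_iff.2 fun ψ => ?_
  by_contra hcon
  obtain ⟨ε, hε, φ, hφ, h⟩ := exists_subseq_of_not_tendsto_zero hcon
  have key : ∀ θ : ℕ → ℕ, StrictMono θ → ¬ WeaklyNull (y ∘ φ ∘ θ) := fun θ hθ hw => by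
    have h1 := (weaklyNull_iff.1 hw ψ).abs
    rw [abs_zero] at h1
    have := ge_of_tendsto h1 (Eventually.of_forall fun k => h (θ k))
    linarith
  -- If one `x m` dominated infinitely many of the selected terms, these would be order bounded and
  -- disjoint, hence weakly null.
  have hfin : Tendsto (n ∘ φ) atTop atTop := by
    rw [← Nat.cofinite_eq_atTop]
    refine Tendsto.cofinite_of_finite_preimage_singleton fun m => ?_
    by_contra hinf
    obtain ⟨θ, hθ, hm⟩ := extraction_of_frequently_atTop
      (Nat.frequently_atTop_iff_infinite.2 hinf : ∃ᶠ k in atTop, (n ∘ φ) k ∈ ({m} : Set ℕ))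
    refine key θ hθ ((hy.comp (hφ.comp hθ).injective).weaklyNull_of_abs_le (u := |x m|) fun k => ?_)
    have h2 : n (φ (θ k)) = m := hm k
    rw [← h2]
    exact hn _
  exact key id strictMono_id ((hx.comp hfin).of_abs_le_of_disjoint (hy.comp hφ.injective)
    fun k => hn _)

/-- If order bounded disjoint sequences are norm null, then a disjoint sequence on which all
weak-star null sequences of functionals tend diagonally to zero is norm null. -/
theorem IsDisjointSeq.tendsto_zero_of_limited
    (hA : ∀ y : ℕ → E, IsDisjointSeq y → ∀ u, (∀ n, |y n| ≤ u) → Tendsto y atTop (𝓝 0))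
    {y : ℕ → E} (hy : IsDisjointSeq y)
    (hlim : ∀ f : ℕ → StrongDual ℝ E, WeakStarNull f → Tendsto (fun n => f n (y n)) atTop (𝓝 0)) :
    Tendsto y atTop (𝓝 0) := by
  -- `f k` norms `y k` and is carried by its band. At a fixed `x` it is controlled by the norm of
  -- `|x| ⊓ m_k |y k|`, a disjoint sequence below `|x|`, so `f` is weak-star null.
  choose f hf1 hf2 using fun k => Seminorm.exists_linearMap_abs_le_eq
    (bandSeminorm _ (normSeminorm_isSolid (E := E)) (y k)) (y k)
  have hfb : ∀ k z, |f k z| ≤ 1 * ‖z‖ := fun k z => by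
    rw [one_mul]; exact (hf1 k z).trans (bandSeminorm_le _ _ _)
  have := hlim (fun k => (f k).mkContinuous 1 (hfb k)) (weakStarNull_iff.2 fun x => by
    choose m hm using fun k : ℕ => exists_bandSeminorm_lt (normSeminorm_isSolid (E := E)) (y k) x
      (Nat.one_div_pos_of_nat (α := ℝ) (n := k))
    have hz : Tendsto (fun k => |x| ⊓ (m k : ℝ) • |y k|) atTop (𝓝 0) := by
      refine hA _ (fun i j hij => ?_) |x| fun k => ?_
      · rw [abs_of_nonneg (abs_inf_smul_nonneg _ _ (Nat.cast_nonneg _)),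
          abs_of_nonneg (abs_inf_smul_nonneg _ _ (Nat.cast_nonneg _))]
        refine inf_eq_zero_mono ?_ (abs_inf_smul_nonneg _ _ (Nat.cast_nonneg _))
          (abs_inf_smul_nonneg _ _ (Nat.cast_nonneg _)) inf_le_right inf_le_right
        refine smul_inf_eq_zero (m i).cast_nonneg (abs_nonneg _)
          (smul_nonneg (m j).cast_nonneg (abs_nonneg _)) ?_
        rw [inf_comm]
        exact smul_inf_eq_zero (m j).cast_nonneg (abs_nonneg _) (abs_nonneg _) (hy j i hij.symm)
      · rw [abs_of_nonneg (abs_inf_smul_nonneg _ _ (Nat.cast_nonneg _))]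
        exact inf_le_left
    have hz' := (tendsto_zero_iff_norm_tendsto_zero.1 hz).add
      (tendsto_one_div_add_atTop_nhds_zero_nat (𝕜 := ℝ))
    rw [add_zero] at hz'
    exact squeeze_zero_norm (fun k => (hf1 k x).trans (hm k).le) hz')
  rw [tendsto_zero_iff_norm_tendsto_zero]
  refine this.congr fun k => ?_
  change f k (y k) = _
  rw [hf2, bandSeminorm_eq_of_abs_le _ le_rfl]
  rfl

/-- A bounded set whose solid hull contains only norm null disjoint sequences is almost order
bounded. -/
theorem exists_norm_posPart_le_of_disjoint [CompleteSpace E] {A : Set E}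
    (hA : Bornology.IsBounded A)
    (h : ∀ y : ℕ → E, IsDisjointSeq y →
      (∀ n, y n ∈ LatticeOrderedAddCommGroup.solidClosure A) → Tendsto y atTop (𝓝 0))
    {ε : ℝ} (hε : 0 < ε) : ∃ u : E, 0 ≤ u ∧ ∀ x ∈ A, ‖(|x| - u)⁺‖ ≤ ε := by
  by_contra hcon
  push Not at hcon
  have hcon' : ∀ u : E, ∃ x ∈ A, 0 ≤ u → ε < ‖(|x| - u)⁺‖ := fun u => by
    by_cases hu : 0 ≤ u
    · obtain ⟨x, hx, h⟩ := hcon u hu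
      exact ⟨x, hx, fun _ => h⟩
    · obtain ⟨x, hx, -⟩ := hcon 0 le_rfl
      exact ⟨x, hx, fun h => absurd h hu⟩
  choose X hXA hX using hcon'
  obtain ⟨C, hC⟩ := hA.exists_norm_le
  -- Greedy choice: `U n` is the sum of the earlier `a i`, and the positive part of `a n - 4 ^ n U
  -- n` has norm above `ε`. Subtracting also `2⁻ⁿ w` makes the excesses disjoint at a vanishing cost
  -- in norm.
  let U : ℕ → E := fun n => Nat.rec 0 (fun n U => U + |X ((4 : ℝ) ^ n • U)|) n
  set a : ℕ → E := fun n => |X ((4 : ℝ) ^ n • U n)| with ha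
  have hU : ∀ n, U (n + 1) = U n + a n := fun _ => rfl
  have ha0 : ∀ n, 0 ≤ a n := fun n => abs_nonneg _
  have hU0 : ∀ n, 0 ≤ U n := fun n => by
    induction n with
    | zero => exact le_rfl
    | succ n ih => rw [hU]; exact add_nonneg ih (ha0 n)
  have hUmono : Monotone U := monotone_nat_of_le_succ fun n => by
    rw [hU]; exact le_add_of_nonneg_right (ha0 n)
  have haU : ∀ {n m}, n < m → a n ≤ U m := fun {n m} hnm => by
    refine le_trans ?_ (hUmono (Nat.succ_le_of_lt hnm))
    rw [Nat.succ_eq_add_one, hU]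
    exact le_add_of_nonneg_left (hU0 n)
  have hεa : ∀ n, ε < ‖(a n - (4 : ℝ) ^ n • U n)⁺‖ := fun n =>
    hX _ (smul_nonneg (by positivity) (hU0 n))
  have haC : ∀ n, ‖a n‖ ≤ C := fun n => by
    rw [ha]; simp only; rw [norm_abs_eq_norm]; exact hC _ (hXA _)
  have hsum : Summable fun n => ((1 / 2 : ℝ) ^ n) • a n := by
    refine Summable.of_norm_bounded (g := fun n => (1 / 2 : ℝ) ^ n * C)
      (summable_geometric_two.mul_right C) fun n => ?_
    rw [norm_smul, Real.norm_of_nonneg (by positivity)]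
    gcongr
    exact haC n
  set w : E := ∑' n, ((1 / 2 : ℝ) ^ n) • a n with hw
  have haw : ∀ n, ((1 / 2 : ℝ) ^ n) • a n ≤ w := fun n =>
    hsum.le_tsum n fun k _ => smul_nonneg (by positivity) (ha0 k)
  have hw0 : 0 ≤ w := (smul_nonneg (by positivity) (ha0 0)).trans (haw 0)
  set y : ℕ → E := fun n => (a n - (4 : ℝ) ^ n • U n - ((1 / 2 : ℝ) ^ n) • w)⁺ with hy
  have hy0 : ∀ n, 0 ≤ y n := fun n => posPart_nonneg _
  have hlt : ∀ n m, n < m → y n ⊓ y m = 0 := by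
    intro n m hnm
    have h1 : y m ≤ (a m - (4 : ℝ) ^ m • a n)⁺ := by
      refine posPart_mono ?_
      refine (sub_le_self _ (smul_nonneg (by positivity) hw0)).trans ?_
      exact sub_le_sub_left (smul_le_smul_of_nonneg_left (haU hnm) (by positivity)) _
    have h2 : y n ≤ (a n - ((1 / 4 : ℝ) ^ m) • a m)⁺ := by
      refine posPart_mono ?_
      refine (sub_le_sub_right (sub_le_self _ (smul_nonneg (by positivity) (hU0 n))) _).trans ?_
      refine sub_le_sub_left ?_ _
      refine le_trans ?_ (smul_le_smul_of_nonneg_left (haw m) (by positivity))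
      rw [smul_smul]
      refine smul_le_smul_of_nonneg_right ?_ (ha0 m)
      rw [show (1 / 4 : ℝ) = 1 / 2 * (1 / 2) by norm_num, mul_pow]
      exact mul_le_mul_of_nonneg_right (pow_le_pow_of_le_one (a := (1 / 2 : ℝ)) (by norm_num)
        (by norm_num) hnm.le) (by positivity)
    -- Up to the factor `4⁻ᵐ`, these are the negative and the positive part of the same element.
    have h3 : (a n - ((1 / 4 : ℝ) ^ m) • a m)⁺ ⊓ (a m - (4 : ℝ) ^ m • a n)⁺ = 0 := by
      have h4 : (1 / 4 : ℝ) ^ m * 4 ^ m = 1 := by rw [← mul_pow]; norm_num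
      have h5 : a n - ((1 / 4 : ℝ) ^ m) • a m =
          ((1 / 4 : ℝ) ^ m) • -(a m - (4 : ℝ) ^ m • a n) := by
        rw [neg_sub, smul_sub, smul_smul, h4, one_smul]
      set b := a m - (4 : ℝ) ^ m • a n
      have h6 : (((1 / 4 : ℝ) ^ m) • -b)⁺ ≤ ((1 / 4 : ℝ) ^ m) • b⁻ := by
        refine sup_le (smul_le_smul_of_nonneg_left (neg_le_negPart b) (by positivity))
          (smul_nonneg (by positivity) (negPart_nonneg b))
      rw [h5]
      refine inf_eq_zero_mono ?_ (posPart_nonneg _) (posPart_nonneg _) h6 le_rfl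
      refine smul_inf_eq_zero (by positivity) (negPart_nonneg _) (posPart_nonneg _) ?_
      rw [inf_comm]
      exact posPart_inf_negPart_eq_zero b
    exact inf_eq_zero_mono h3 (hy0 n) (hy0 m) h2 h1
  have hdisj : IsDisjointSeq y := fun m n hmn => by
    rw [abs_of_nonneg (hy0 m), abs_of_nonneg (hy0 n)]
    rcases hmn.lt_or_gt with h | h
    · exact hlt m n h
    · rw [inf_comm]; exact hlt n m h
  have hya : ∀ n, y n ≤ a n := fun n => by
    refine sup_le ?_ (ha0 n)
    exact (sub_le_self _ (smul_nonneg (by positivity) hw0)).trans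
      (sub_le_self _ (smul_nonneg (by positivity) (hU0 n)))
  have hlim := h y hdisj fun n => ⟨_, hXA ((4 : ℝ) ^ n • U n), by
    rw [abs_of_nonneg (hy0 n)]; exact hya n⟩
  have hnorm : ∀ n, ε - (1 / 2 : ℝ) ^ n * ‖w‖ ≤ ‖y n‖ := fun n => by
    have h1 := lipschitzWith_posPart.dist_le_mul (a n - (4 : ℝ) ^ n • U n)
      (a n - (4 : ℝ) ^ n • U n - ((1 / 2 : ℝ) ^ n) • w)
    rw [dist_eq_norm, dist_eq_norm, sub_sub_cancel, norm_smul,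
      Real.norm_of_nonneg (by positivity), NNReal.coe_one, one_mul] at h1
    have h2 := norm_sub_norm_le (a n - (4 : ℝ) ^ n • U n)⁺ (y n)
    have h3 := hεa n
    linarith
  have hl1 : Tendsto (fun n => ε - (1 / 2 : ℝ) ^ n * ‖w‖) atTop (𝓝 (ε - 0 * ‖w‖)) :=
    tendsto_const_nhds.sub ((tendsto_pow_atTop_nhds_zero_of_lt_one (by norm_num)
      (by norm_num)).mul_const _)
  have := le_of_tendsto_of_tendsto' hl1 (tendsto_zero_iff_norm_tendsto_zero.1 hlim) hnorm
  linarith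

end Disjoint

/-- A sequence is Cauchy if the consecutive differences of all its subsequences are null. -/
theorem cauchySeq_of_subseq_sub_tendsto_zero {X : Type*} [NormedAddCommGroup X] {x : ℕ → X}
    (h : ∀ φ : ℕ → ℕ, StrictMono φ →
      Tendsto (fun k => x (φ (k + 1)) - x (φ k)) atTop (𝓝 0)) : CauchySeq x := by
  rw [Metric.cauchySeq_iff']
  by_contra hcon
  push Not at hcon
  obtain ⟨ε, hε, hcon⟩ := hcon
  choose F hF1 hF2 using hcon
  let φ : ℕ → ℕ := fun k => Nat.rec 0 (fun _ a => F a) k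
  have hφ1 : ∀ k, φ (k + 1) = F (φ k) := fun _ => rfl
  have hφ : StrictMono φ := strictMono_nat_of_lt_succ fun k => by
    rw [hφ1]
    refine lt_of_le_of_ne (hF1 _) fun he => ?_
    have := hF2 (φ k)
    rw [← he, dist_self] at this
    exact absurd hε (not_lt.2 this)
  have h0 := tendsto_zero_iff_norm_tendsto_zero.1 (h φ hφ)
  have := ge_of_tendsto h0 (Eventually.of_forall fun k => by
    rw [← dist_eq_norm, hφ1]; exact hF2 (φ k))
  exact absurd hε (not_lt.2 this)

/-- Every increasing order bounded sequence is norm Cauchy. -/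
def MonotoneSeqCauchy (E : Type*) [NormedAddCommGroup E] [Lattice E] : Prop :=
  ∀ x : ℕ → E, Monotone x → BddAbove (Set.range x) → CauchySeq x

/-- Every order bounded disjoint sequence is norm null. -/
def OrderBoundedDisjointNull (E : Type*) [NormedAddCommGroup E] [Lattice E] : Prop :=
  ∀ y : ℕ → E, IsDisjointSeq y → ∀ u, (∀ n, |y n| ≤ u) → Tendsto y atTop (𝓝 0)

/-! ### Order continuity, monotone sequences and components. -/

section Order

variable {E : Type*} [NormedAddCommGroup E] [NormedSpace ℝ E] [Lattice E] [IsOrderedAddMonoid E]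
  [IsOrderedModule ℝ E] [HasSolidNorm E]

/-- By disjointness the partial sums of `|y k|` stay below `u`; they converge, so their increments
vanish. -/
theorem MonotoneSeqCauchy.orderBoundedDisjointNull [CompleteSpace E] (hS : MonotoneSeqCauchy E) :
    OrderBoundedDisjointNull E := by
  intro y hy u hu
  have hmono : Monotone fun n => ∑ k ∈ Finset.range n, |y k| := monotone_nat_of_le_succ fun n => by
    rw [Finset.sum_range_succ]
    exact le_add_of_nonneg_right (abs_nonneg _)
  have hbdd : BddAbove (Set.range fun n => ∑ k ∈ Finset.range n, |y k|) := by
    refine ⟨u, ?_⟩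
    rintro _ ⟨n, rfl⟩
    exact sum_le_of_pairwise_inf_eq_zero _ _ u ((abs_nonneg _).trans (hu 0))
      (fun _ _ => abs_nonneg _) (fun i _ => hu i) fun i _ j _ hij => hy i j hij
  obtain ⟨L, hL⟩ := cauchySeq_tendsto_of_complete (hS _ hmono hbdd)
  have h1 := (hL.comp (tendsto_add_atTop_nat 1)).sub hL
  rw [sub_self] at h1
  rw [tendsto_zero_iff_norm_tendsto_zero] at h1 ⊢
  refine h1.congr fun n => ?_
  simp only [Function.comp_apply, Finset.sum_range_succ, add_sub_cancel_left, norm_abs_eq_norm]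

/-- Increments along a subsequence are positive and telescope below a fixed element, so every
functional is absolutely summable on them. -/
theorem HasSchurProperty.monotoneSeqCauchy (h : HasSchurProperty E) : MonotoneSeqCauchy E := by
  intro x hx ⟨b, hb⟩
  refine cauchySeq_of_subseq_sub_tendsto_zero fun φ hφ => h _ (weaklyNull_iff.2 fun ψ => ?_)
  have hd : ∀ k, 0 ≤ x (φ (k + 1)) - x (φ k) := fun k =>
    sub_nonneg.2 (hx (hφ.monotone k.le_succ))
  have : Summable fun k => |ψ (x (φ (k + 1)) - x (φ k))| :=
    summable_of_sum_range_le (c := ‖ψ‖ * ‖b - x (φ 0)‖) (fun _ => abs_nonneg _) fun n => by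
      refine sum_abs_apply_le_of_sum_abs_le ψ _ _ _ ?_
      simp only [abs_of_nonneg (hd _)]
      rw [Finset.sum_range_sub (fun k => x (φ k))]
      exact sub_le_sub_right (hb ⟨_, rfl⟩) _
  exact this.of_abs.tendsto_atTop_zero

theorem nonpos_of_forall_nat_smul_le {z b : E} (h : ∀ n : ℕ, (n : ℝ) • z ≤ b) : z ≤ 0 := by
  have h1 : Tendsto (fun n : ℕ => (1 / ((n : ℝ) + 1)) • b) atTop (𝓝 ((0 : ℝ) • b)) :=
    tendsto_one_div_add_atTop_nhds_zero_nat.smul_const b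
  rw [zero_smul] at h1
  refine ge_of_tendsto h1 (Eventually.of_forall fun n => ?_)
  have h2 := smul_le_smul_of_nonneg_left (h (n + 1)) (by positivity : 0 ≤ 1 / ((n : ℝ) + 1))
  rwa [smul_smul, Nat.cast_succ, one_div_mul_cancel (by positivity), one_smul] at h2

/-- Order continuity is applied to the differences of upper bounds and terms. Subtracting a lower
bound `z` of these from an upper bound leaves an upper bound; iteration bounds all `k z`, whence `z
≤ 0`. -/
theorem HasOrderContinuousNorm.monotoneSeqCauchy (h : HasOrderContinuousNorm E) :
    MonotoneSeqCauchy E := by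
  intro x hx ⟨b, hb⟩
  let D : Set E := {d | ∃ y ∈ upperBounds (Set.range x), ∃ n, d = y - x n}
  have hne : D.Nonempty := ⟨b - x 0, b, hb, 0, rfl⟩
  have hdir : DirectedOn (· ≥ ·) D := by
    rintro _ ⟨y, hy, n, rfl⟩ _ ⟨z, hz, m, rfl⟩
    refine ⟨_, ⟨y ⊓ z, fun w hw => le_inf (hy hw) (hz hw), max n m, rfl⟩, ?_, ?_⟩
    · exact sub_le_sub inf_le_left (hx (le_max_left n m))
    · exact sub_le_sub inf_le_right (hx (le_max_right n m))
  have hglb : IsGLB D 0 := by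
    refine ⟨?_, fun z hz => ?_⟩
    · rintro _ ⟨y, hy, n, rfl⟩
      exact sub_nonneg.2 (hy ⟨n, rfl⟩)
    · have key : ∀ k : ℕ, b - (k : ℝ) • z ∈ upperBounds (Set.range x) := fun k => by
        induction k with
        | zero => simpa using hb
        | succ k ih =>
          rintro _ ⟨n, rfl⟩
          have := hz ⟨_, ih, n, rfl⟩
          rw [le_sub_comm] at this
          rwa [Nat.cast_succ, add_smul, one_smul, ← sub_sub]
      refine nonpos_of_forall_nat_smul_le (b := b - x 0) fun k => ?_
      rw [le_sub_comm]
      exact key k ⟨0, rfl⟩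
  rw [Metric.cauchySeq_iff']
  intro ε hε
  obtain ⟨_, ⟨y, hy, n, rfl⟩, hlt⟩ := h D hne hdir hglb ε hε
  refine ⟨n, fun m hm => ?_⟩
  rw [dist_eq_norm]
  exact (norm_le_norm_of_nonneg_of_le (sub_nonneg.2 (hx hm))
    (sub_le_sub_right (hy ⟨m, rfl⟩) _)).trans_lt hlt

theorem MonotoneSeqCauchy.cauchySeq_of_antitone (hS : MonotoneSeqCauchy E) {x : ℕ → E}
    (hx : Antitone x) (hb : BddBelow (Set.range x)) : CauchySeq x := by
  obtain ⟨b, hb⟩ := hb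
  have h := hS (fun n => -x n) (fun _ _ h => neg_le_neg (hx h)) ⟨-b, by
    rintro _ ⟨n, rfl⟩; exact neg_le_neg (hb ⟨n, rfl⟩)⟩
  rw [Metric.cauchySeq_iff'] at h ⊢
  simpa only [dist_neg_neg] using h

theorem MonotoneSeqCauchy.hasOrderContinuousNorm [CompleteSpace E] (hS : MonotoneSeqCauchy E) :
    HasOrderContinuousNorm E := by
  intro D hne hdir hglb ε hε
  -- Otherwise one could descend in `D` forever by steps of norm at least `δ`.
  have h1 : ∀ δ > 0, ∃ x ∈ D, ∀ y ∈ D, y ≤ x → ‖x - y‖ < δ := by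
    intro δ hδ
    by_contra hcon
    push Not at hcon
    obtain ⟨d0, hd0⟩ := hne
    choose F hFD hF1 hF2 using fun x : D => hcon x x.2
    let X : ℕ → D := fun n => Nat.rec ⟨d0, hd0⟩ (fun _ d => ⟨F d, hFD d⟩) n
    have hX : ∀ n, (X (n + 1)).1 ≤ (X n).1 ∧ δ ≤ ‖(X n).1 - (X (n + 1)).1‖ := fun n =>
      ⟨hF1 (X n), hF2 (X n)⟩
    have hc := hS.cauchySeq_of_antitone (x := fun n => (X n).1)
      (antitone_nat_of_succ_le fun n => (hX n).1)
      ⟨0, by rintro _ ⟨n, rfl⟩; exact hglb.1 (X n).2⟩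
    obtain ⟨N, hN⟩ := Metric.cauchySeq_iff'.1 hc δ hδ
    have h2 := hN (N + 1) N.le_succ
    rw [dist_comm, dist_eq_norm] at h2
    exact absurd h2 (not_lt.2 (hX N).2)
  choose d hdD hd using fun n : ℕ => h1 (1 / ((n : ℝ) + 1)) (by positivity)
  choose m hmD hm1 hm2 using fun a b : D => hdir a a.2 b b.2
  let X : ℕ → D := fun n => Nat.rec ⟨d 0, hdD 0⟩ (fun n x => ⟨m x ⟨d (n + 1), hdD _⟩, hmD _ _⟩) n
  have hXd : ∀ n, (X n).1 ≤ d n := fun n => by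
    cases n with
    | zero => exact le_rfl
    | succ n => exact hm2 _ _
  have hXanti : Antitone fun n => (X n).1 := antitone_nat_of_succ_le fun n => hm1 _ _
  have hXd' : ∀ n, ∀ y ∈ D, y ≤ (X n).1 → ‖(X n).1 - y‖ < 1 / ((n : ℝ) + 1) := fun n y hy hyx =>
    (norm_le_norm_of_nonneg_of_le (sub_nonneg.2 hyx) (sub_le_sub_right (hXd n) _)).trans_lt
      (hd n y hy (hyx.trans (hXd n)))
  obtain ⟨z, hz⟩ := cauchySeq_tendsto_of_complete (hS.cauchySeq_of_antitone hXanti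
      ⟨0, by rintro _ ⟨n, rfl⟩; exact hglb.1 (X n).2⟩)
  have hz0 : 0 ≤ z := ge_of_tendsto' hz fun n => hglb.1 (X n).2
  -- For `y` in `D`, `(X n - y)⁺` is at most `X n` minus a common lower bound of `X n` and `y` in
  -- `D`, which is small in norm. So the limit `z` is a lower bound of `D`.
  have hzle : z ≤ 0 := hglb.2 fun y hy => by
    have h2 : Tendsto (fun n => ((X n).1 - y)⁺) atTop (𝓝 (z - y)⁺) :=
      (continuous_posPart.tendsto _).comp (hz.sub_const y)
    have h3 : Tendsto (fun n => ((X n).1 - y)⁺) atTop (𝓝 0) := by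
      refine squeeze_zero_norm (fun n => ?_) (tendsto_one_div_add_atTop_nhds_zero_nat (𝕜 := ℝ))
      have h5 : m (X n) ⟨y, hy⟩ ≤ y := hm2 (X n) ⟨y, hy⟩
      refine le_trans ?_ (hXd' n (m (X n) ⟨y, hy⟩) (hmD _ _) (hm1 _ _)).le
      exact norm_le_norm_of_nonneg_of_le (posPart_nonneg _)
        (sup_le (sub_le_sub_left h5 _) (sub_nonneg.2 (hm1 _ _)))
    have h4 := tendsto_nhds_unique h2 h3
    rwa [posPart_eq_zero, sub_nonpos] at h4
  have hz' : z = 0 := le_antisymm hzle hz0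
  rw [hz'] at hz
  obtain ⟨n, hn⟩ := ((tendsto_zero_iff_norm_tendsto_zero.1 hz).eventually
    (gt_mem_nhds hε)).exists
  exact ⟨(X n).1, (X n).2, hn⟩

theorem MonotoneSeqCauchy.exists_isLUB_tendsto [CompleteSpace E] (hS : MonotoneSeqCauchy E)
    {x : ℕ → E} (hx : Monotone x) (hb : BddAbove (Set.range x)) :
    ∃ L, IsLUB (Set.range x) L ∧ Tendsto x atTop (𝓝 L) := by
  obtain ⟨L, hL⟩ := cauchySeq_tendsto_of_complete (hS x hx hb)
  exact ⟨L, isLUB_of_tendsto_atTop hx hL, hL⟩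

theorem MonotoneSeqCauchy.isSigmaDedekindComplete [CompleteSpace E] (hS : MonotoneSeqCauchy E) :
    IsSigmaDedekindComplete E := by
  intro S hne hc hb
  obtain ⟨f, rfl⟩ := hc.exists_eq_range hne
  obtain ⟨L, hL, -⟩ := hS.exists_isLUB_tendsto (partialSups f).monotone
    (bddAbove_range_partialSups.2 hb)
  refine ⟨L, ?_⟩
  rwa [IsLUB, upperBounds_range_partialSups] at hL

/-- `e` is the component of `u` in the band of `v`. Adding `(u - e) ⊓ v` to `u ⊓ m v` stays below `u
⊓ (m + 1) v ≤ e`, so it could be subtracted from the supremum and must vanish. -/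
theorem IsSigmaDedekindComplete.exists_component (hE : IsSigmaDedekindComplete E) {u v : E}
    (hu : 0 ≤ u) (hv : 0 ≤ v) : ∃ e, 0 ≤ e ∧ e ≤ u ∧
      IsLUB (Set.range fun m : ℕ => u ⊓ (m : ℝ) • v) e ∧ (u - e) ⊓ v = 0 ∧ (u - e) ⊓ e = 0 := by
  obtain ⟨e, he⟩ := hE (Set.range fun m : ℕ => u ⊓ (m : ℝ) • v) (Set.range_nonempty _)
    (Set.countable_range _) ⟨u, by rintro _ ⟨m, rfl⟩; exact inf_le_left⟩
  have he0 : 0 ≤ e := (le_inf hu (smul_nonneg (Nat.cast_nonneg 0) hv)).trans (he.1 ⟨0, rfl⟩)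
  have heu : e ≤ u := he.2 (by rintro _ ⟨m, rfl⟩; exact inf_le_left)
  have hue : 0 ≤ u - e := sub_nonneg.2 heu
  have h1 : (u - e) ⊓ v = 0 := by
    refine le_antisymm ?_ (le_inf hue hv)
    have : e ≤ e - (u - e) ⊓ v := he.2 (by
      rintro _ ⟨m, rfl⟩
      rw [le_sub_iff_add_le]
      refine le_trans (le_inf ?_ ?_) (he.1 ⟨m + 1, rfl⟩)
      · calc u ⊓ (m : ℝ) • v + (u - e) ⊓ v ≤ e + (u - e) := add_le_add (he.1 ⟨m, rfl⟩) inf_le_left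
          _ = u := by abel
      · rw [Nat.cast_succ, add_smul, one_smul]
        exact add_le_add inf_le_right inf_le_right)
    rwa [le_sub_self_iff] at this
  refine ⟨e, he0, heu, he, h1, ?_⟩
  have h2 : ∀ m : ℕ, (u ⊓ (m : ℝ) • v) ⊓ (u - e) = 0 := fun m => by
    refine inf_eq_zero_mono ?_ (le_inf hu (smul_nonneg m.cast_nonneg hv)) hue inf_le_right le_rfl
    exact smul_inf_eq_zero m.cast_nonneg hv hue (by rwa [inf_comm])
  refine le_antisymm ?_ (le_inf hue he0)
  have : e ≤ e - (u - e) ⊓ e := he.2 (by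
    rintro _ ⟨m, rfl⟩
    rw [le_sub_iff_add_le]
    refine add_le_of_inf_eq_zero ?_ (he.1 ⟨m, rfl⟩) inf_le_right
    exact inf_eq_zero_mono (h2 m) (le_inf hu (smul_nonneg m.cast_nonneg hv)) (le_inf hue he0)
      le_rfl inf_le_left)
  rwa [le_sub_self_iff] at this

/-- Increments along a subsequence are disjoint: the later one lies below `u - e (φ n)`, the earlier
one below `e (φ n)`. -/
theorem OrderBoundedDisjointNull.cauchySeq_of_components (hA : OrderBoundedDisjointNull E)
    {u : E} {e : ℕ → E} (he : Monotone e) (he0 : ∀ n, 0 ≤ e n) (heu : ∀ n, e n ≤ u)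
    (hc : ∀ n, (u - e n) ⊓ e n = 0) : CauchySeq e := by
  refine cauchySeq_of_subseq_sub_tendsto_zero fun φ hφ => ?_
  have hd : ∀ k, 0 ≤ e (φ (k + 1)) - e (φ k) := fun k =>
    sub_nonneg.2 (he (hφ.monotone k.le_succ))
  have hlt : ∀ m n, m < n →
      (e (φ (n + 1)) - e (φ n)) ⊓ (e (φ (m + 1)) - e (φ m)) = 0 := fun m n hmn => by
    refine inf_eq_zero_mono (hc (φ n)) (hd n) (hd m) (sub_le_sub_right (heu _) _) ?_
    exact (sub_le_self _ (he0 _)).trans (he (hφ.monotone (Nat.succ_le_of_lt hmn)))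
  refine hA _ (fun m n hmn => ?_) u fun n => ?_
  · rw [abs_of_nonneg (hd m), abs_of_nonneg (hd n)]
    rcases hmn.lt_or_gt with h | h
    · rw [inf_comm]; exact hlt m n h
    · exact hlt n m h
  · rw [abs_of_nonneg (hd n)]
    exact (sub_le_self _ (he0 _)).trans (heu _)

/-- The component `e n` of `u` in the band where `x n` exceeds `(1 - l) u` satisfies `(1 - l) e n ≤
x n`, so `u - x n ≤ (u - e n) + l u`. These components increase and converge in norm, and their
limit is `u`. -/
theorem OrderBoundedDisjointNull.exists_norm_sub_lt [CompleteSpace E]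
    (hA : OrderBoundedDisjointNull E) (hE : IsSigmaDedekindComplete E) {x : ℕ → E} {u : E}
    (hx : Monotone x) (hx0 : ∀ n, 0 ≤ x n) (hu : IsLUB (Set.range x) u) {ε : ℝ} (hε : 0 < ε) :
    ∃ n, ‖u - x n‖ < ε := by
  have hu0 : 0 ≤ u := (hx0 0).trans (hu.1 ⟨0, rfl⟩)
  obtain ⟨l, hl0, hl1, hlu⟩ : ∃ l : ℝ, 0 < l ∧ l < 1 ∧ l * ‖u‖ < ε / 2 := by
    refine ⟨min (1 / 2) (ε / (4 * (‖u‖ + 1))), by positivity,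
      (min_le_left _ _).trans_lt (by norm_num), ?_⟩
    calc min (1 / 2) (ε / (4 * (‖u‖ + 1))) * ‖u‖ ≤ ε / (4 * (‖u‖ + 1)) * (‖u‖ + 1) := by
          gcongr
          · exact min_le_right _ _
          · linarith
      _ = ε / 4 := by field_simp
      _ < ε / 2 := by linarith
  set v : ℕ → E := fun n => (x n - (1 - l) • u)⁺ with hv
  have hv0 : ∀ n, 0 ≤ v n := fun n => posPart_nonneg _
  have hvmono : Monotone v := fun n m h => posPart_mono (sub_le_sub_right (hx h) _)
  choose e he0 heu helub hev hee using fun n => hE.exists_component hu0 (hv0 n)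
  have hemono : Monotone e := fun n m h => (helub n).2 (by
    rintro _ ⟨k, rfl⟩
    exact (inf_le_inf_left _ (smul_le_smul_of_nonneg_left (hvmono h) k.cast_nonneg)).trans
      ((helub m).1 ⟨k, rfl⟩))
  obtain ⟨L, hL⟩ := cauchySeq_tendsto_of_complete (hA.cauchySeq_of_components hemono he0 heu hee)
  have hLe : ∀ n, e n ≤ L := fun n => hemono.ge_of_tendsto hL n
  have hLu : L ≤ u := le_of_tendsto' hL heu
  have hvl : ∀ n, v n ≤ l • u := fun n => by
    refine sup_le ?_ (smul_nonneg hl0.le hu0)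
    rw [sub_le_iff_le_add, ← add_smul, add_sub_cancel, one_smul]
    exact hu.1 ⟨n, rfl⟩
  have hw0 : 0 ≤ u - L := sub_nonneg.2 hLu
  have hlu0 : 0 ≤ l • u := smul_nonneg hl0.le hu0
  -- This part of the gap is disjoint from every `v n`, so together they stay below `l u`, and `u -
  -- c` still bounds all `x n`.
  have hc0 : (u - L) ⊓ l • u = 0 := by
    set c := (u - L) ⊓ l • u with hc
    have hc0 : 0 ≤ c := le_inf hw0 hlu0
    refine le_antisymm ?_ hc0
    have : u ≤ u - c := hu.2 (by
      rintro _ ⟨n, rfl⟩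
      have h1 : c ⊓ v n = 0 := inf_eq_zero_mono (hev n) hc0 (hv0 n)
        (inf_le_left.trans (sub_le_sub_left (hLe n) _)) le_rfl
      have h2 : c + v n ≤ l • u := add_le_of_inf_eq_zero h1 inf_le_right (hvl n)
      have h3 : x n - (1 - l) • u ≤ v n := le_posPart _
      calc x n = (c + (x n - (1 - l) • u)) + ((1 - l) • u - c) := by abel
        _ ≤ (c + v n) + ((1 - l) • u - c) := by gcongr
        _ ≤ l • u + ((1 - l) • u - c) := by gcongr
        _ = (l • u + (1 - l) • u) - c := by abel
        _ = u - c := by rw [← add_smul, add_sub_cancel, one_smul])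
    rwa [le_sub_self_iff] at this
  have hLeq : u - L = 0 := by
    have h1 : l • (u - L) ≤ (u - L) ⊓ l • u := by
      refine le_inf ?_ (smul_le_smul_of_nonneg_left (sub_le_self _ ((he0 0).trans (hLe 0))) hl0.le)
      simpa using smul_le_smul_of_nonneg_right hl1.le hw0
    rw [hc0] at h1
    refine le_antisymm ?_ hw0
    have := smul_le_smul_of_nonneg_left h1 (inv_pos.2 hl0).le
    rwa [smul_smul, inv_mul_cancel₀ hl0.ne', one_smul, smul_zero] at this
  rw [sub_eq_zero] at hLeq
  rw [← hLeq] at hL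
  obtain ⟨n, hn⟩ := (Metric.tendsto_atTop.1 hL) (ε / 2) (by positivity)
  have hn := hn n le_rfl
  refine ⟨n, ?_⟩
  have hxe : (1 - l) • e n ≤ x n := by
    have hl' : 0 < 1 - l := sub_pos.2 hl1
    have h1 : e n ≤ (1 - l)⁻¹ • x n := (helub n).2 (by
      rintro _ ⟨m, rfl⟩
      set t := (x n - (1 - l) • u)⁻ with ht
      have ht0 : 0 ≤ t := negPart_nonneg _
      have h2 : t ⊓ (((1 - l) * m) • v n) = 0 := by
        rw [inf_comm]
        exact smul_inf_eq_zero (by positivity) (hv0 n) ht0 (posPart_inf_negPart_eq_zero _)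
      have h3 : (1 - l) • u ≤ x n + t := by
        have := neg_le_negPart (x n - (1 - l) • u)
        rw [neg_sub, sub_le_iff_le_add'] at this
        exact this
      have h4 : (1 - l) • (u ⊓ (m : ℝ) • v n) ≤ x n := by
        rw [smul_inf_of_nonneg hl'.le, smul_smul]
        refine (inf_le_inf_right _ h3).trans ((add_inf_le_inf_add_inf (hx0 n) ht0
          (smul_nonneg (by positivity) (hv0 n))).trans ?_)
        rw [h2, add_zero]
        exact inf_le_left
      have := smul_le_smul_of_nonneg_left h4 (inv_pos.2 hl').le
      rwa [smul_smul, inv_mul_cancel₀ hl'.ne', one_smul] at this)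
    have := smul_le_smul_of_nonneg_left h1 hl'.le
    rwa [smul_smul, mul_inv_cancel₀ hl'.ne', one_smul] at this
  have hfin : u - x n ≤ (u - e n) + l • u := by
    calc u - x n ≤ u - (1 - l) • e n := sub_le_sub_left hxe _
      _ = (u - e n) + l • e n := by rw [sub_smul, one_smul]; abel
      _ ≤ (u - e n) + l • u := by gcongr; exact heu n
  calc ‖u - x n‖ ≤ ‖(u - e n) + l • u‖ :=
        norm_le_norm_of_nonneg_of_le (sub_nonneg.2 (hu.1 ⟨n, rfl⟩)) hfin
    _ ≤ ‖u - e n‖ + l * ‖u‖ := by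
        refine (norm_add_le _ _).trans ?_
        rw [norm_smul, Real.norm_of_nonneg hl0.le]
    _ < ε := by
        rw [dist_comm, dist_eq_norm] at hn
        linarith

theorem OrderBoundedDisjointNull.monotoneSeqCauchy [CompleteSpace E]
    (hA : OrderBoundedDisjointNull E) (hE : IsSigmaDedekindComplete E) : MonotoneSeqCauchy E := by
  intro x hx ⟨b, hb⟩
  set y : ℕ → E := fun n => x n - x 0 with hy
  have hymono : Monotone y := fun n m h => sub_le_sub_right (hx h) _
  obtain ⟨u, hu⟩ := hE (Set.range y) (Set.range_nonempty _) (Set.countable_range _)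
    ⟨b - x 0, by rintro _ ⟨n, rfl⟩; exact sub_le_sub_right (hb ⟨n, rfl⟩) _⟩
  rw [Metric.cauchySeq_iff']
  intro ε hε
  obtain ⟨n, hn⟩ := hA.exists_norm_sub_lt hE hymono (fun n => sub_nonneg.2 (hx n.zero_le)) hu hε
  refine ⟨n, fun m hm => ?_⟩
  rw [dist_eq_norm]
  refine (norm_le_norm_of_nonneg_of_le (sub_nonneg.2 (hx hm)) ?_).trans_lt hn
  have h1 : x m - x n = y m - y n := by simp [hy]
  rw [h1]
  exact sub_le_sub_right (hu.1 ⟨m, rfl⟩) _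

end Order

/-! ### Rademacher signs and Bessel's inequality. -/

section Rademacher

/-- The Rademacher signs on finite subsets of `ℕ`. -/
noncomputable def rademacherSign (j : ℕ) (s : Finset ℕ) : ℝ := if j ∈ s then 1 else -1

theorem rademacherSign_mul_self (j : ℕ) (s : Finset ℕ) :
    rademacherSign j s * rademacherSign j s = 1 := by
  unfold rademacherSign; split_ifs <;> norm_num

theorem abs_rademacherSign (j : ℕ) (s : Finset ℕ) : |rademacherSign j s| = 1 := by
  unfold rademacherSign; split_ifs <;> norm_num

/-- Toggling `i` in `s` is an involution that flips one sign and keeps the other. -/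
theorem sum_rademacherSign_mul {n i j : ℕ} (hi : i < n) (hij : i ≠ j) :
    ∑ s ∈ (Finset.range n).powerset, rademacherSign i s * rademacherSign j s = 0 := by
  refine Finset.sum_involution (fun s _ => symmDiff s {i}) ?_ ?_ ?_ ?_
  · intro s _
    have h1 : rademacherSign i (symmDiff s {i}) = -rademacherSign i s := by
      unfold rademacherSign
      by_cases h : i ∈ s <;> simp [Finset.mem_symmDiff, h]
    have h2 : rademacherSign j (symmDiff s {i}) = rademacherSign j s := by
      unfold rademacherSign
      by_cases h : j ∈ s <;> simp [Finset.mem_symmDiff, h, hij.symm]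
    rw [h1, h2]
    ring
  · intro s _ _ h
    have h3 : i ∈ symmDiff s {i} ↔ i ∈ s := by rw [h]
    by_cases h4 : i ∈ s <;> simp [Finset.mem_symmDiff, h4] at h3
  · intro s hs
    rw [Finset.mem_powerset] at hs ⊢
    intro k hk
    rcases Finset.mem_symmDiff.1 hk with h | h
    · exact hs h.1
    · rw [Finset.mem_singleton.1 h.1]; exact Finset.mem_range.2 hi
  · intro s _
    exact symmDiff_symmDiff_cancel_right _ _

/-- Bessel's inequality for Rademacher averages. -/
theorem sum_sq_rademacher_average_le {n J : ℕ} (hJ : J ≤ n) (a : Finset ℕ → ℝ) {B : ℝ}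
    (ha : ∀ s, |a s| ≤ B) :
    ∑ j ∈ Finset.range J,
      (((2 : ℝ) ^ n)⁻¹ * ∑ s ∈ (Finset.range n).powerset, rademacherSign j s * a s) ^ 2 ≤ B ^ 2 := by
  set P := (Finset.range n).powerset with hP
  set N : ℝ := (2 : ℝ) ^ n with hN
  have hN0 : 0 < N := by positivity
  have hcard : (P.card : ℝ) = N := by rw [hP, Finset.card_powerset, Finset.card_range]; simp [hN]
  set c : ℕ → ℝ := fun j => N⁻¹ * ∑ s ∈ P, rademacherSign j s * a s with hc
  have hcN : ∀ j, ∑ s ∈ P, rademacherSign j s * a s = N * c j := fun j => by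
    rw [hc]; simp only; rw [← mul_assoc, mul_inv_cancel₀ hN0.ne', one_mul]
  have h0 : 0 ≤ ∑ s ∈ P, (a s - ∑ j ∈ Finset.range J, c j * rademacherSign j s) ^ 2 :=
    Finset.sum_nonneg fun _ _ => sq_nonneg _
  have h1 : ∑ s ∈ P, (a s - ∑ j ∈ Finset.range J, c j * rademacherSign j s) ^ 2 =
      ∑ s ∈ P, a s ^ 2 - 2 * ∑ s ∈ P, a s * ∑ j ∈ Finset.range J, c j * rademacherSign j s +
        ∑ s ∈ P, (∑ j ∈ Finset.range J, c j * rademacherSign j s) ^ 2 := by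
    rw [Finset.mul_sum, ← Finset.sum_sub_distrib, ← Finset.sum_add_distrib]
    exact Finset.sum_congr rfl fun s _ => by ring
  have h2 : ∑ s ∈ P, a s * ∑ j ∈ Finset.range J, c j * rademacherSign j s =
      N * ∑ j ∈ Finset.range J, c j ^ 2 := by
    simp only [Finset.mul_sum]
    rw [Finset.sum_comm]
    refine Finset.sum_congr rfl fun j _ => ?_
    calc ∑ s ∈ P, a s * (c j * rademacherSign j s) =
          c j * ∑ s ∈ P, rademacherSign j s * a s := by
          rw [Finset.mul_sum]; exact Finset.sum_congr rfl fun s _ => by ring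
      _ = N * c j ^ 2 := by rw [hcN]; ring
  have h3 : ∑ s ∈ P, (∑ j ∈ Finset.range J, c j * rademacherSign j s) ^ 2 =
      N * ∑ j ∈ Finset.range J, c j ^ 2 := by
    simp only [sq, Finset.sum_mul_sum]
    rw [Finset.sum_comm, Finset.mul_sum]
    refine Finset.sum_congr rfl fun i hi => ?_
    rw [Finset.sum_comm, Finset.sum_eq_single_of_mem i hi]
    · calc ∑ s ∈ P, c i * rademacherSign i s * (c i * rademacherSign i s) =
            ∑ s ∈ P, c i * c i := Finset.sum_congr rfl fun s _ => by
              rw [mul_mul_mul_comm, rademacherSign_mul_self, mul_one]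
        _ = N * (c i * c i) := by rw [Finset.sum_const, nsmul_eq_mul, hcard]
    · intro j _ hji
      calc ∑ s ∈ P, c i * rademacherSign i s * (c j * rademacherSign j s) =
            c i * c j * ∑ s ∈ P, rademacherSign i s * rademacherSign j s := by
              rw [Finset.mul_sum]; exact Finset.sum_congr rfl fun s _ => by ring
        _ = 0 := by
          rw [sum_rademacherSign_mul (lt_of_lt_of_le (Finset.mem_range.1 hi) hJ) hji.symm, mul_zero]
  have h4 : ∑ s ∈ P, a s ^ 2 ≤ N * B ^ 2 := by
    rw [← hcard, ← nsmul_eq_mul]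
    refine Finset.sum_le_card_nsmul _ _ _ fun s _ => ?_
    exact sq_le_sq' (by linarith [neg_abs_le (a s), ha s]) ((le_abs_self _).trans (ha s))
  rw [h1, h2, h3] at h0
  have h5 : N * ∑ j ∈ Finset.range J, c j ^ 2 ≤ N * B ^ 2 := by linarith
  exact le_of_mul_le_mul_left h5 hN0

end Rademacher

/-! ### Weak-star null sequences from Rademacher averages. -/

section Averages

variable {X : Type*} [NormedAddCommGroup X] [NormedSpace ℝ X]

/-- Weak-star limits of the Rademacher averages of a family in the dual unit ball form a weak-star
null sequence. -/
theorem exists_weakStarNull_of_rademacher (f : Finset ℕ → StrongDual ℝ X) (hf : ∀ s, ‖f s‖ ≤ 1) :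
    ∃ h : ℕ → StrongDual ℝ X, WeakStarNull h ∧ ∀ (j : ℕ) (w : X) (δ : ℝ),
      (∀ s, δ ≤ rademacherSign j s * f s w) → δ ≤ h j w := by
  let g : ℕ → ℕ → StrongDual ℝ X := fun n j =>
    ((2 : ℝ) ^ n)⁻¹ • ∑ s ∈ (Finset.range n).powerset, rademacherSign j s • f s
  have hgapp : ∀ n j x, g n j x =
      ((2 : ℝ) ^ n)⁻¹ * ∑ s ∈ (Finset.range n).powerset, rademacherSign j s * f s x := by
    intro n j x
    simp [g]
  have hg1 : ∀ n j, ‖g n j‖ ≤ 1 := by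
    intro n j
    rw [norm_smul, Real.norm_of_nonneg (by positivity), inv_mul_le_iff₀ (by positivity), mul_one]
    refine (norm_sum_le _ _).trans ?_
    refine (Finset.sum_le_card_nsmul _ _ 1 fun s _ => ?_).trans ?_
    · rw [norm_smul, Real.norm_eq_abs, abs_rademacherSign, one_mul]; exact hf s
    · rw [Finset.card_powerset, Finset.card_range, nsmul_eq_mul, mul_one]; simp
  have hex : ∀ j, ∃ h : StrongDual ℝ X, ∀ x,
      Tendsto (fun n => g n j x) (hyperfilter ℕ : Filter ℕ) (𝓝 (h x)) := by
    intro j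
    have hK := WeakDual.isCompact_closedBall (𝕜 := ℝ) (E := X) 0 1
    obtain ⟨h, -, hh⟩ := hK.ultrafilter_le_nhds
      ((hyperfilter ℕ).map fun n => StrongDual.toWeakDual (g n j)) (by
        rw [le_principal_iff]
        refine mem_map.2 (Filter.univ_mem' fun n => ?_)
        change g n j ∈ Metric.closedBall (0 : StrongDual ℝ X) 1
        rw [mem_closedBall_zero_iff]
        exact hg1 n j)
    refine ⟨WeakDual.toStrongDual h, fun x => ?_⟩
    have ht : Tendsto (fun n => StrongDual.toWeakDual (g n j)) (hyperfilter ℕ : Filter ℕ) (𝓝 h) :=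
      hh
    exact (tendsto_iff_forall_eval_tendsto_topDualPairing.1 ht) x
  choose h hh using hex
  refine ⟨h, weakStarNull_iff.2 fun x => ?_, fun j w δ hδ => ?_⟩
  -- Bessel's inequality survives the limit along the ultrafilter, so the squares of `h j x` are
  -- summable in `j`.
  · have hsum : Summable fun j => h j x ^ 2 := by
      refine summable_of_sum_range_le (c := ‖x‖ ^ 2) (fun _ => sq_nonneg _) fun J => ?_
      have ht : Tendsto (fun n => ∑ j ∈ Finset.range J, g n j x ^ 2) (hyperfilter ℕ : Filter ℕ)
          (𝓝 (∑ j ∈ Finset.range J, h j x ^ 2)) :=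
        tendsto_finsetSum _ fun j _ => (hh j x).pow 2
      refine le_of_tendsto ht ?_
      have hev : ∀ᶠ n in (hyperfilter ℕ : Filter ℕ), J ≤ n :=
        Nat.hyperfilter_le_atTop (eventually_ge_atTop J)
      filter_upwards [hev] with n hn
      simp only [hgapp]
      refine sum_sq_rademacher_average_le hn (fun s => f s x) fun s => ?_
      have := (f s).le_of_opNorm_le (hf s) x
      rwa [one_mul] at this
    have h0 := hsum.tendsto_atTop_zero
    rw [tendsto_zero_iff_abs_tendsto_zero]
    have h1 := h0.sqrt
    simp only [Real.sqrt_sq_eq_abs, Real.sqrt_zero] at h1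
    exact h1
  · refine ge_of_tendsto (hh j w) (Eventually.of_forall fun n => ?_)
    rw [hgapp, le_inv_mul_iff₀ (by positivity)]
    have := Finset.card_nsmul_le_sum (Finset.range n).powerset
      (fun s => rademacherSign j s * f s w) δ fun s _ => hδ s
    rwa [Finset.card_powerset, Finset.card_range, nsmul_eq_mul, Nat.cast_pow, Nat.cast_ofNat]
      at this

end Averages

/-! ### Signed order sums; limited order intervals. -/

section Lattice

variable {E : Type*} [NormedAddCommGroup E] [NormedSpace ℝ E] [Lattice E] [IsOrderedAddMonoid E]
  [IsOrderedModule ℝ E] [HasSolidNorm E]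

theorem IsLUB.inf_eq_zero_of_forall {T : Set E} {M a : E} (hM : IsLUB T M) (hM0 : 0 ≤ M)
    (ha : 0 ≤ a) (hT : ∀ t ∈ T, 0 ≤ t ∧ t ⊓ a = 0) : M ⊓ a = 0 := by
  have hc : 0 ≤ M ⊓ a := le_inf hM0 ha
  refine le_antisymm ?_ hc
  have : M ≤ M - M ⊓ a := hM.2 fun t ht => by
    rw [le_sub_iff_add_le]
    exact add_le_of_inf_eq_zero (inf_eq_zero_mono (hT t ht).2 (hT t ht).1 hc le_rfl inf_le_right)
      (hM.1 ht) inf_le_left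
  rwa [le_sub_self_iff] at this

theorem IsLUB.sub_inf_eq_zero_of_forall {T : Set E} {M a : E} (hM : IsLUB T M)
    (ha : 0 ≤ a) (haT : a ∈ T) (hT : ∀ t ∈ T, t ≠ a → 0 ≤ t ∧ t ⊓ a = 0) : (M - a) ⊓ a = 0 := by
  have hc : 0 ≤ (M - a) ⊓ a := le_inf (sub_nonneg.2 (hM.1 haT)) ha
  refine le_antisymm ?_ hc
  have : M ≤ M - (M - a) ⊓ a := hM.2 fun t ht => by
    rw [le_sub_iff_add_le]
    by_cases h : t = a
    · rw [h]
      calc a + (M - a) ⊓ a ≤ a + (M - a) := by gcongr; exact inf_le_left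
        _ = M := by abel
    · exact add_le_of_inf_eq_zero (inf_eq_zero_mono (hT t ht h).2 (hT t ht h).1 hc le_rfl
        inf_le_right) (hM.1 ht) (inf_le_right.trans (hM.1 haT))
  rwa [le_sub_self_iff] at this

/-- Signed order sums of a disjoint order bounded family. -/
theorem IsSigmaDedekindComplete.exists_signed_sum (hE : IsSigmaDedekindComplete E) {ι : Type*}
    [Countable ι] {x : ι → E} {u : E} (hu : 0 ≤ u) (hx0 : ∀ i, 0 ≤ x i) (hxu : ∀ i, x i ≤ u)
    (hd : ∀ i j, i ≠ j → x i ⊓ x j = 0) (S : Set ι) :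
    ∃ w : E, |w| ≤ u ∧ (∀ i ∈ S, |w - x i| ⊓ x i = 0) ∧ ∀ i ∉ S, |w + x i| ⊓ x i = 0 := by
  -- Adjoining 0 covers the case of empty `S` and makes the supremum nonnegative.
  have hsup : ∀ S : Set ι, ∃ P, IsLUB (insert 0 (x '' S)) P ∧ 0 ≤ P ∧ P ≤ u := by
    intro S
    have hub : u ∈ upperBounds (insert 0 (x '' S)) := by
      rintro _ (rfl | ⟨i, -, rfl⟩)
      exacts [hu, hxu i]
    obtain ⟨P, hP⟩ := hE (insert 0 (x '' S)) (Set.insert_nonempty _ _)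
      ((S.to_countable.image x).insert 0) ⟨u, hub⟩
    exact ⟨P, hP, hP.1 (Set.mem_insert _ _), hP.2 hub⟩
  have key : ∀ (S : Set ι) (P M : E), IsLUB (insert 0 (x '' S)) P → 0 ≤ P →
      IsLUB (insert 0 (x '' Sᶜ)) M → 0 ≤ M → ∀ i ∈ S, |P - M - x i| ⊓ x i = 0 := by
    intro S P M hP hP0 hM hM0 i hi
    have hiP : x i ∈ insert 0 (x '' S) := Set.mem_insert_of_mem _ ⟨i, hi, rfl⟩
    have h1 : (P - x i) ⊓ x i = 0 := hP.sub_inf_eq_zero_of_forall (hx0 i) hiP (by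
      rintro _ (rfl | ⟨j, -, rfl⟩) hne
      · exact ⟨le_rfl, inf_eq_left.2 (hx0 i)⟩
      · exact ⟨hx0 j, hd j i fun h => hne (by rw [h])⟩)
    have h2 : M ⊓ x i = 0 := hM.inf_eq_zero_of_forall hM0 (hx0 i) (by
      rintro _ (rfl | ⟨j, hj, rfl⟩)
      · exact ⟨le_rfl, inf_eq_left.2 (hx0 i)⟩
      · exact ⟨hx0 j, hd j i fun h => hj (h ▸ hi)⟩)
    have h3 : 0 ≤ P - x i := sub_nonneg.2 (hP.1 hiP)
    refine inf_eq_zero_mono (add_inf_eq_zero h3 hM0 (hx0 i) h1 h2) (abs_nonneg _) (hx0 i) ?_ le_rfl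
    rw [sub_right_comm]
    refine abs_le'.2 ⟨(sub_le_self _ hM0).trans (le_add_of_nonneg_right hM0), ?_⟩
    rw [neg_sub]
    exact (sub_le_self _ h3).trans (le_add_of_nonneg_left h3)
  obtain ⟨P, hP, hP0, hPu⟩ := hsup S
  obtain ⟨M, hM, hM0, hMu⟩ := hsup Sᶜ
  refine ⟨P - M, ?_, key S P M hP hP0 hM hM0, fun i hi => ?_⟩
  · refine abs_le'.2 ⟨(sub_le_self _ hM0).trans hPu, ?_⟩
    rw [neg_sub]
    exact (sub_le_self _ hP0).trans hMu
  · have := key Sᶜ M P hM hM0 (by rwa [compl_compl]) hP0 i hi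
    rwa [← abs_neg, show -(M - P - x i) = P - M + x i by abel] at this

/-- `f s` sees only the term `± x s` of the signed sum `w j`, the rest being disjoint from `x s`.
The Rademacher sign cancels the sign of that term, so every averaged value at `w j` is at least `δ`.
-/
theorem orderBoundedDisjointNull_of_limited (hE : IsSigmaDedekindComplete E)
    (hlim : ∀ u : E, ∀ h : ℕ → StrongDual ℝ E, WeakStarNull h → ∀ w : ℕ → E, (∀ n, |w n| ≤ u) →
      Tendsto (fun n => h n (w n)) atTop (𝓝 0)) : OrderBoundedDisjointNull E := by
  intro y hy u hu
  rw [tendsto_zero_iff_norm_tendsto_zero]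
  by_contra hcon
  obtain ⟨δ, hδ, φ, hφ, hyδ⟩ := exists_subseq_of_not_tendsto_zero hcon
  have hu0 : 0 ≤ u := (abs_nonneg _).trans (hu 0)
  let x : Finset ℕ → E := fun s => |y (φ (Encodable.encode s))|
  have hx0 : ∀ s, 0 ≤ x s := fun s => abs_nonneg _
  have hxδ : ∀ s, δ ≤ ‖x s‖ := fun s => by
    have := hyδ (Encodable.encode s)
    rwa [abs_norm, ← norm_abs_eq_norm] at this
  have hd : ∀ s t, s ≠ t → x s ⊓ x t = 0 := fun s t hst =>
    hy _ _ (hφ.injective.ne (Encodable.encode_injective.ne hst))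
  choose f hf1 hf2 using fun s => Seminorm.exists_linearMap_abs_le_eq
    (bandSeminorm _ (normSeminorm_isSolid (E := E)) (x s)) (x s)
  have hf0 : ∀ s z, |z| ⊓ x s = 0 → f s z = 0 := fun s z hz => by
    have := hf1 s z
    rw [bandSeminorm_eq_zero_of_disjoint _ (by rwa [abs_of_nonneg (hx0 s)])] at this
    exact abs_nonpos_iff.1 this
  have hfx : ∀ s, f s (x s) = ‖x s‖ := fun s => by
    rw [hf2, bandSeminorm_eq_of_abs_le _ le_rfl]; rfl
  have hfb : ∀ s z, |f s z| ≤ 1 * ‖z‖ := fun s z => by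
    rw [one_mul]; exact (hf1 s z).trans (bandSeminorm_le _ _ _)
  obtain ⟨h, hh, hhδ⟩ := exists_weakStarNull_of_rademacher
    (fun s => (f s).mkContinuous 1 (hfb s))
    (fun s => LinearMap.mkContinuous_norm_le _ zero_le_one _)
  choose w hwu hw1 hw2 using fun j : ℕ => hE.exists_signed_sum hu0 hx0 (fun s => hu _) hd {s | j ∈ s}
  have h1 : ∀ j, δ ≤ h j (w j) := fun j => hhδ j _ _ fun s => by
    refine (hxδ s).trans (le_of_eq ?_)
    change ‖x s‖ = rademacherSign j s * f s (w j)
    unfold rademacherSign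
    split_ifs with hj
    · have := hf0 s _ (hw1 j s hj)
      rw [map_sub, sub_eq_zero, hfx] at this
      rw [one_mul, this]
    · have := hf0 s _ (hw2 j s hj)
      rw [map_add, hfx] at this
      linarith
  have := ge_of_tendsto' (hlim u h hh w hwu) h1
  linarith

end Lattice

/-! ### Weakly Cauchy subsequences in Hilbert spaces. -/

section Hilbert

/-- Bounded sequences in a Hilbert space have weakly Cauchy subsequences. -/
theorem exists_subseq_forall_cauchySeq_inner {H : Type*} [NormedAddCommGroup H]
    [InnerProductSpace ℝ H] [CompleteSpace H] {ξ : ℕ → H} {M : ℝ} (hM : ∀ n, ‖ξ n‖ ≤ M) :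
    ∃ φ : ℕ → ℕ, StrictMono φ ∧ ∀ h : H, CauchySeq fun n => inner ℝ (ξ (φ n)) h := by
  have hM0 : 0 ≤ M := (norm_nonneg _).trans (hM 0)
  have hK : IsCompact (Set.univ.pi fun _ : ℕ => Set.Icc (-(M * M)) (M * M)) :=
    isCompact_univ_pi fun _ => isCompact_Icc
  obtain ⟨a, -, φ, hφ, ha⟩ := hK.isSeqCompact (x := fun n m => inner ℝ (ξ n) (ξ m)) (by
    intro n m _
    exact abs_le.1 ((abs_real_inner_le_norm _ _).trans
      (mul_le_mul (hM n) (hM m) (norm_nonneg _) hM0)))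
  refine ⟨φ, hφ, ?_⟩
  have hmem : ∀ m, CauchySeq fun n => inner ℝ (ξ (φ n)) (ξ m) := fun m =>
    ((tendsto_pi_nhds.1 ha) m).cauchySeq
  -- The good test vectors form a closed subspace containing every `ξ m`; on its orthogonal
  -- complement all inner products vanish.
  let S : Submodule ℝ H :=
    { carrier := {h | CauchySeq fun n => inner ℝ (ξ (φ n)) h}
      zero_mem' := by
        change CauchySeq fun n => inner ℝ (ξ (φ n)) (0 : H)
        simp only [inner_zero_right]
        exact cauchySeq_const 0
      add_mem' := fun {a b} ha hb => by
        change CauchySeq fun n => inner ℝ (ξ (φ n)) (a + b)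
        simp only [inner_add_right]
        exact ha.add hb
      smul_mem' := fun c a ha => by
        change CauchySeq fun n => inner ℝ (ξ (φ n)) (c • a)
        simp only [inner_smul_right]
        obtain ⟨l, hl⟩ := cauchySeq_tendsto_of_complete ha
        exact (hl.const_mul c).cauchySeq }
  have hclosed : ∀ h ∈ S.topologicalClosure, h ∈ S := by
    intro h hh
    change CauchySeq fun n => inner ℝ (ξ (φ n)) h
    rw [Metric.cauchySeq_iff']
    intro ε hε
    obtain ⟨b, hb, hbd⟩ := Metric.mem_closure_iff.1 hh (ε / (3 * (M + 1))) (by positivity)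
    obtain ⟨N, hN⟩ := Metric.cauchySeq_iff'.1 (show CauchySeq fun n => inner ℝ (ξ (φ n)) b from hb)
      (ε / 3) (by positivity)
    refine ⟨N, fun n hn => ?_⟩
    have h1 : ∀ n, |inner ℝ (ξ (φ n)) h - inner ℝ (ξ (φ n)) b| < ε / 3 := fun n => by
      rw [← inner_sub_right]
      refine (abs_real_inner_le_norm _ _).trans_lt ?_
      rw [dist_eq_norm] at hbd
      calc ‖ξ (φ n)‖ * ‖h - b‖ ≤ (M + 1) * ‖h - b‖ := by gcongr; linarith [hM (φ n)]
        _ < (M + 1) * (ε / (3 * (M + 1))) := by gcongr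
        _ = ε / 3 := by field_simp
    have h2 := hN n hn
    rw [Real.dist_eq] at h2 ⊢
    have h3 := h1 n
    have h4 := h1 N
    rw [abs_lt] at *
    constructor <;> linarith [h2.1, h2.2, h3.1, h3.2, h4.1, h4.2]
  intro h
  have : CompleteSpace S.topologicalClosure :=
    (Submodule.isClosed_topologicalClosure S).completeSpace_coe
  obtain ⟨y, hy, z, hz, rfl⟩ := S.topologicalClosure.exists_add_mem_mem_orthogonal h
  have hz0 : ∀ n, inner ℝ (ξ (φ n)) z = 0 := fun n =>
    (Submodule.mem_orthogonal _ _).1 hz _ (S.le_topologicalClosure (hmem _))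
  simp only [inner_add_right, hz0, add_zero]
  exact hclosed y hy

end Hilbert

/-! ### Mazur's theorem and Hilbert completion for seminorms. -/

section SeminormedSpace

variable {V : Type*} [AddCommGroup V] [Module ℝ V]

/-- Mazur's theorem for a seminorm. -/
theorem Seminorm.exists_mem_convexHull_lt (p : Seminorm ℝ V) {v : ℕ → V}
    (hv : ∀ (f : V →ₗ[ℝ] ℝ) (C : ℝ), (∀ x, |f x| ≤ C * p x) →
      Tendsto (fun n => f (v n)) atTop (𝓝 0)) {ε : ℝ} (hε : 0 < ε) :
    ∃ z ∈ convexHull ℝ (Set.range v), p z < ε := by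
  let : SeminormedAddCommGroup V := p.toAddGroupSeminorm.toSeminormedAddCommGroup
  let : NormedSpace ℝ V := ⟨fun c x => (map_smul_eq_mul p c x).le⟩
  have h0 : (0 : V) ∈ closure (convexHull ℝ (Set.range v)) := by
    by_contra hcon
    obtain ⟨f, u, hu, hfu⟩ := geometric_hahn_banach_point_closed
      (convex_convexHull ℝ (Set.range v)).closure isClosed_closure hcon
    rw [map_zero] at hu
    have h1 := hv f.toLinearMap ‖f‖ fun x => f.le_opNorm x
    have := ge_of_tendsto' h1 fun n =>
      (hfu _ (subset_closure (subset_convexHull ℝ _ ⟨n, rfl⟩))).le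
    linarith
  obtain ⟨z, hz, hd⟩ := Metric.mem_closure_iff.1 h0 ε hε
  refine ⟨z, hz, ?_⟩
  rw [dist_zero_left] at hd
  exact hd

/-- A seminorm with the parallelogram law is the pullback of a Hilbert space norm. -/
theorem Seminorm.exists_hilbert.{u} {V : Type u} [AddCommGroup V] [Module ℝ V] (p : Seminorm ℝ V)
    (hp : ∀ x y, p (x + y) ^ 2 + p (x - y) ^ 2 = 2 * (p x ^ 2 + p y ^ 2)) :
    ∃ (H : Type u) (_ : NormedAddCommGroup H) (_ : InnerProductSpace ℝ H) (_ : CompleteSpace H)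
      (J : V →ₗ[ℝ] H), (∀ v, ‖J v‖ = p v) ∧ ∀ (f : V →ₗ[ℝ] ℝ) (C : ℝ), 0 ≤ C →
        (∀ x, |f x| ≤ C * p x) → ∃ g : H, ‖g‖ ≤ C ∧ ∀ x, f x = inner ℝ g (J x) := by
  let : SeminormedAddCommGroup V := p.toAddGroupSeminorm.toSeminormedAddCommGroup
  let : NormedSpace ℝ V := ⟨fun c x => (map_smul_eq_mul p c x).le⟩
  let H := UniformSpace.Completion V
  have hnorm : ∀ x : V, ‖((x : UniformSpace.Completion V) : H)‖ = p x := fun x =>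
    UniformSpace.Completion.norm_coe x
  have hpar : ∀ x y : H, ‖x + y‖ * ‖x + y‖ + ‖x - y‖ * ‖x - y‖ = 2 * (‖x‖ * ‖x‖ + ‖y‖ * ‖y‖) := by
    intro x y
    induction x, y using UniformSpace.Completion.induction_on₂ with
    | hp => exact isClosed_eq (by fun_prop) (by fun_prop)
    | ih a b =>
      rw [← UniformSpace.Completion.coe_add, ← UniformSpace.Completion.coe_sub]
      rw [hnorm, hnorm, hnorm, hnorm]
      have := hp a b
      linarith
  -- Jordan–von Neumann: the parallelogram law, extended by density to the completion, yields the
  -- inner product.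
  let : InnerProductSpace ℝ H := InnerProductSpace.ofNorm ℝ hpar
  let J : V →L[ℝ] H := UniformSpace.Completion.toComplL
  have hJ : ∀ v, ‖J v‖ = p v := fun v => UniformSpace.Completion.norm_coe v
  refine ⟨H, inferInstance, inferInstance, inferInstance, J.toLinearMap, hJ, ?_⟩
  intro f C hC hf
  let F : V →L[ℝ] ℝ := f.mkContinuous C hf
  have hdense : DenseRange J := UniformSpace.Completion.denseRange_coe
  have hind : IsUniformInducing J := UniformSpace.Completion.isUniformInducing_coe V
  let G : StrongDual ℝ H := F.extend J
  have hG : ∀ v, G (J v) = f v := fun v => F.extend_eq hdense hind v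
  have hGb : ‖G‖ ≤ C := by
    refine G.opNorm_le_bound hC fun h => ?_
    induction h using hdense.induction_on with
    | hp => exact isClosed_le (by fun_prop) (by fun_prop)
    | ih v => rw [hG, hJ]; exact hf v
  refine ⟨(InnerProductSpace.toDual ℝ H).symm G, by rwa [LinearIsometryEquiv.norm_map],
    fun x => ?_⟩
  rw [InnerProductSpace.toDual_symm_apply]
  exact (hG x).symm

end SeminormedSpace

/-! ### Positive functionals controlling the norm on an order interval. -/

section Dominating

variable {E : Type*} [NormedAddCommGroup E] [NormedSpace ℝ E] [Lattice E] [IsOrderedAddMonoid E]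
  [IsOrderedModule ℝ E] [HasSolidNorm E]

/-- The part of the norm carried by the band generated by `u`. -/
noncomputable def bandNorm (u : E) : Seminorm ℝ E :=
  bandSeminorm _ (normSeminorm_isSolid (E := E)) u

theorem bandNorm_isSolid (u : E) : (bandNorm u).IsSolid := bandSeminorm_isSolid _ u

theorem bandNorm_le (u x : E) : bandNorm u x ≤ ‖x‖ := bandSeminorm_le _ u x

theorem bandNorm_eq_norm {u x : E} (hx : 0 ≤ x) (hxu : x ≤ u) : bandNorm u x = ‖x‖ :=
  bandSeminorm_eq_of_abs_le _ (abs_le_abs_of_nonneg hx hxu)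

theorem LinearMap.mono_of_nonneg {f : E →ₗ[ℝ] ℝ} (hf : ∀ x, 0 ≤ x → 0 ≤ f x) {x y : E}
    (h : x ≤ y) : f x ≤ f y := by
  have := hf _ (sub_nonneg.2 h)
  rw [map_sub] at this
  linarith

/-- Hahn–Banach is applied to `y ↦ bandNorm u y⁺`. This vanishes at `-y` for `y ≥ 0`, which forces
positivity of the functional. -/
theorem exists_nonneg_linearMap_eq_norm {u x : E} (hx : 0 ≤ x) (hxu : x ≤ u) :
    ∃ f : E →ₗ[ℝ] ℝ, (∀ y, 0 ≤ y → 0 ≤ f y) ∧ (∀ y, |f y| ≤ bandNorm u y) ∧ f x = ‖x‖ := by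
  have hsol := bandNorm_isSolid u
  obtain ⟨f, hf, hfx⟩ := exists_linearMap_le_sublinear_eq (fun y => bandNorm u y⁺)
    (fun c hc y => by
      have : (c • y)⁺ = c • y⁺ := by
        refine le_antisymm (sup_le (smul_le_smul_of_nonneg_left (le_posPart y) hc.le)
          (smul_nonneg hc.le (posPart_nonneg y))) ?_
        have h1 : y⁺ ≤ c⁻¹ • (c • y)⁺ := by
          refine sup_le ?_ (smul_nonneg (inv_pos.2 hc).le (posPart_nonneg _))
          have := smul_le_smul_of_nonneg_left (le_posPart (c • y)) (inv_pos.2 hc).le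
          rwa [smul_smul, inv_mul_cancel₀ hc.ne', one_smul] at this
        have := smul_le_smul_of_nonneg_left h1 hc.le
        rwa [smul_smul, mul_inv_cancel₀ hc.ne', one_smul] at this
      simp only [this]
      rw [map_smul_eq_mul, Real.norm_of_nonneg hc.le])
    (fun y z => by
      refine le_trans (hsol.mono (posPart_nonneg _) ?_) (map_add_le_add _ _ _)
      exact sup_le (add_le_add (le_posPart y) (le_posPart z))
        (add_nonneg (posPart_nonneg y) (posPart_nonneg z))) x
  have hpos : ∀ y : E, bandNorm u y⁺ ≤ bandNorm u y := fun y => hsol (by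
    rw [abs_of_nonneg (posPart_nonneg y)]; exact sup_le (le_abs_self y) (abs_nonneg y))
  refine ⟨f, fun y hy => ?_, fun y => abs_le'.2 ⟨(hf y).trans (hpos y), ?_⟩, ?_⟩
  · have := hf (-y)
    rw [posPart_eq_zero.2 (neg_nonpos.2 hy), map_zero, map_neg] at this
    linarith
  · have := (hf (-y)).trans (hpos (-y))
    rwa [map_neg, map_neg_eq_map] at this
  · rw [hfx]
    rw [posPart_eq_self.2 hx, bandNorm_eq_norm hx hxu]

/-- The cone of positive functionals dominated by a multiple of `bandNorm u`. -/
def IsBandDominated (u : E) (φ : E →ₗ[ℝ] ℝ) : Prop :=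
  (∀ x, 0 ≤ x → 0 ≤ φ x) ∧ ∃ C : ℝ, 0 ≤ C ∧ ∀ x, |φ x| ≤ C * bandNorm u x

theorem IsBandDominated.add {u : E} {φ χ : E →ₗ[ℝ] ℝ} (hφ : IsBandDominated u φ)
    (hχ : IsBandDominated u χ) : IsBandDominated u (φ + χ) := by
  obtain ⟨h1, C, hC0, hC⟩ := hφ
  obtain ⟨h2, D, hD0, hD⟩ := hχ
  refine ⟨fun x hx => add_nonneg (h1 x hx) (h2 x hx), C + D, add_nonneg hC0 hD0, fun x => ?_⟩
  rw [LinearMap.add_apply, add_mul]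
  exact (abs_add_le _ _).trans (add_le_add (hC x) (hD x))

theorem IsBandDominated.smul {u : E} {φ : E →ₗ[ℝ] ℝ} (hφ : IsBandDominated u φ) {c : ℝ}
    (hc : 0 ≤ c) : IsBandDominated u (c • φ) := by
  obtain ⟨h1, C, hC0, hC⟩ := hφ
  refine ⟨fun x hx => mul_nonneg hc (h1 x hx), c * C, mul_nonneg hc hC0, fun x => ?_⟩
  rw [LinearMap.smul_apply, smul_eq_mul, abs_mul, abs_of_nonneg hc, mul_assoc]
  exact mul_le_mul_of_nonneg_left (hC x) hc

/-- Otherwise choose `x n` in `[0, u]` of norm above `ε` on which the sum of the earlier norming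
functionals `f i` is at most `2⁻ⁿ ‖u‖`. The tail suprema `s n` of `x` decrease in norm to some `L`
with `f i L ≤ 0` for all `i`, yet `f n (s n - L) ≥ ‖x n‖ > ε`. -/
theorem MonotoneSeqCauchy.exists_norm_le_add [CompleteSpace E] (hS : MonotoneSeqCauchy E) {u : E}
    (hu : 0 ≤ u) {ε : ℝ} (hε : 0 < ε) :
    ∃ φ, IsBandDominated u φ ∧ ∀ x, 0 ≤ x → x ≤ u → ‖x‖ ≤ φ x + ε := by
  by_contra hcon
  push Not at hcon
  have hcon' : ∀ φ : E →ₗ[ℝ] ℝ, ∃ x, 0 ≤ x ∧ x ≤ u ∧ (IsBandDominated u φ → φ x + ε < ‖x‖) := by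
    intro φ
    by_cases h : IsBandDominated u φ
    · obtain ⟨x, h1, h2, h3⟩ := hcon φ h
      exact ⟨x, h1, h2, fun _ => h3⟩
    · exact ⟨0, le_rfl, hu, fun h' => absurd h' h⟩
  choose X hX0 hXu hX using hcon'
  choose G hG0 hGb hGX using fun φ => exists_nonneg_linearMap_eq_norm (hX0 φ) (hXu φ)
  let φ : ℕ → E →ₗ[ℝ] ℝ := fun n => Nat.rec 0 (fun n φ => φ + G ((2 : ℝ) ^ n • φ)) n
  set x : ℕ → E := fun n => X ((2 : ℝ) ^ n • φ n) with hx
  set f : ℕ → E →ₗ[ℝ] ℝ := fun n => G ((2 : ℝ) ^ n • φ n) with hf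
  have hφ1 : ∀ n, φ (n + 1) = φ n + f n := fun _ => rfl
  have hfpos : ∀ n y, 0 ≤ y → 0 ≤ f n y := fun n => hG0 _
  have hfb : ∀ n y, |f n y| ≤ ‖y‖ := fun n y => (hGb _ y).trans (bandNorm_le u y)
  have hx0 : ∀ n, 0 ≤ x n := fun n => hX0 _
  have hxu : ∀ n, x n ≤ u := fun n => hXu _
  have hfx : ∀ n, f n (x n) = ‖x n‖ := fun n => hGX _
  have hφ : ∀ n, IsBandDominated u (φ n) := fun n => by
    induction n with
    | zero => exact ⟨fun _ _ => le_rfl, 0, le_rfl, fun y => by simp [φ]⟩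
    | succ n ih =>
      rw [hφ1]
      exact ih.add ⟨hfpos n, 1, zero_le_one, fun y => by rw [one_mul]; exact hGb _ y⟩
  have hlt : ∀ n, (2 : ℝ) ^ n * φ n (x n) + ε < ‖x n‖ := fun n =>
    hX _ ((hφ n).smul (by positivity))
  have hfφ : ∀ i n, i < n → ∀ y, 0 ≤ y → f i y ≤ φ n y := by
    intro i n hin y hy
    induction n with
    | zero => omega
    | succ n ih =>
      rw [hφ1, LinearMap.add_apply]
      rcases Nat.lt_succ_iff_lt_or_eq.1 hin with h | rfl
      · have := ih h
        have := hfpos n y hy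
        linarith
      · have := (hφ i).1 y hy
        linarith
  have hfix : ∀ i n, i < n → f i (x n) ≤ (1 / 2 : ℝ) ^ n * ‖u‖ := by
    intro i n hin
    have h1 := hfφ i n hin (x n) (hx0 n)
    have h2 := hlt n
    have h3 : ‖x n‖ ≤ ‖u‖ := norm_le_norm_of_nonneg_of_le (hx0 n) (hxu n)
    rw [one_div, inv_pow, le_inv_mul_iff₀ (by positivity)]
    have h4 : (2 : ℝ) ^ n * f i (x n) ≤ 2 ^ n * φ n (x n) := by gcongr
    linarith
  choose s hs1 hs2 using fun n => hS.exists_isLUB_tendsto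
    (partialSups fun k => x (n + k)).monotone (bddAbove_range_partialSups.2 ⟨u, by
      rintro _ ⟨k, rfl⟩; exact hxu _⟩)
  have hslub : ∀ n, IsLUB (Set.range fun k => x (n + k)) (s n) := fun n => by
    have := hs1 n
    rwa [IsLUB, upperBounds_range_partialSups] at this
  have hxs : ∀ n, x n ≤ s n := fun n => (hslub n).1 ⟨0, rfl⟩
  have hsanti : Antitone s := fun n m hnm => (hslub m).2 (by
    rintro _ ⟨k, rfl⟩
    refine (hslub n).1 ⟨m - n + k, ?_⟩
    simp only
    congr 1
    omega)
  have hfs : ∀ i n, i < n → f i (s n) ≤ (1 / 2 : ℝ) ^ n * (2 * ‖u‖) := by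
    intro i n hin
    have hcont : Continuous (f i) := AddMonoidHomClass.continuous_of_bound (f i) 1 fun y => by
      rw [one_mul]; exact hfb i y
    refine le_of_tendsto' ((hcont.tendsto _).comp (hs2 n)) fun m => ?_
    have h1 : partialSups (fun k => x (n + k)) m ≤ ∑ k ∈ Finset.range (m + 1), x (n + k) :=
      partialSups_le _ _ _ fun k hk => Finset.single_le_sum (f := fun k => x (n + k))
        (fun j _ => hx0 _) (Finset.mem_range.2 (Nat.lt_succ_of_le hk))
    calc f i (partialSups (fun k => x (n + k)) m) ≤ f i (∑ k ∈ Finset.range (m + 1), x (n + k)) :=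
          LinearMap.mono_of_nonneg (hfpos i) h1
      _ = ∑ k ∈ Finset.range (m + 1), f i (x (n + k)) := map_sum _ _ _
      _ ≤ ∑ k ∈ Finset.range (m + 1), (1 / 2 : ℝ) ^ (n + k) * ‖u‖ :=
          Finset.sum_le_sum fun k _ => hfix i _ (by omega)
      _ = (1 / 2 : ℝ) ^ n * ((∑ k ∈ Finset.range (m + 1), (1 / 2 : ℝ) ^ k) * ‖u‖) := by
          rw [Finset.sum_mul, Finset.mul_sum]
          exact Finset.sum_congr rfl fun k _ => by rw [pow_add]; ring
      _ ≤ (1 / 2 : ℝ) ^ n * (2 * ‖u‖) := by gcongr; exact sum_geometric_two_le _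
  obtain ⟨L, hL⟩ := cauchySeq_tendsto_of_complete (hS.cauchySeq_of_antitone hsanti
    ⟨0, by rintro _ ⟨n, rfl⟩; exact (hx0 n).trans (hxs n)⟩)
  have hLs : ∀ n, L ≤ s n := fun n => hsanti.le_of_tendsto hL n
  have hfL : ∀ i, f i L ≤ 0 := fun i => by
    have ht : Tendsto (fun n : ℕ => (1 / 2 : ℝ) ^ n * (2 * ‖u‖)) atTop (𝓝 (0 * (2 * ‖u‖))) :=
      (tendsto_pow_atTop_nhds_zero_of_lt_one (by norm_num) (by norm_num)).mul_const _
    rw [zero_mul] at ht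
    refine ge_of_tendsto ht (eventually_atTop.2 ⟨i + 1, fun n hn => ?_⟩)
    exact (LinearMap.mono_of_nonneg (hfpos i) (hLs n)).trans (hfs i n hn)
  have hfin : ∀ n, ε ≤ ‖s n - L‖ := fun n => by
    have h1 := hlt n
    have h2 : 0 ≤ (2 : ℝ) ^ n * φ n (x n) := mul_nonneg (by positivity) ((hφ n).1 _ (hx0 n))
    have h3 := LinearMap.mono_of_nonneg (hfpos n) (hxs n)
    have h4 := (le_abs_self _).trans (hfb n (s n - L))
    rw [map_sub] at h4
    have h5 := hfL n
    rw [hfx] at h3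
    linarith
  have h0 := hL.sub_const L
  rw [sub_self, tendsto_zero_iff_norm_tendsto_zero] at h0
  have := ge_of_tendsto' h0 hfin
  linarith

/-- A positive functional, carried by the band generated by `u`, that controls the norm on the
order interval `[0, u]`. -/
theorem MonotoneSeqCauchy.exists_control [CompleteSpace E] (hS : MonotoneSeqCauchy E) {u : E}
    (hu : 0 ≤ u) : ∃ φ, IsBandDominated u φ ∧
      ∀ ε > 0, ∃ C : ℝ, 0 ≤ C ∧ ∀ x, 0 ≤ x → x ≤ u → ‖x‖ ≤ C * φ x + ε := by
  choose f hf hfε using fun n : ℕ => hS.exists_norm_le_add hu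
    (Nat.one_div_pos_of_nat (α := ℝ) (n := n))
  choose hf0 C hC0 hC using hf
  have hb : ∀ n y, |(1 / 2 : ℝ) ^ n * ((C n + 1)⁻¹ * f n y)| ≤ (1 / 2 : ℝ) ^ n * bandNorm u y := by
    intro n y
    have hC1 : 0 < C n + 1 := by linarith [hC0 n]
    rw [abs_mul, abs_of_nonneg (by positivity : (0 : ℝ) ≤ (1 / 2) ^ n), abs_mul,
      abs_of_nonneg (inv_pos.2 hC1).le]
    gcongr
    rw [inv_mul_le_iff₀ hC1]
    refine (hC n y).trans ?_
    have := apply_nonneg (bandNorm u) y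
    linarith
  have hsumB : ∀ y, Summable fun n => (1 / 2 : ℝ) ^ n * bandNorm u y := fun y =>
    summable_geometric_two.mul_right _
  have hsum : ∀ y, Summable fun n => (1 / 2 : ℝ) ^ n * ((C n + 1)⁻¹ * f n y) := fun y =>
    Summable.of_norm_bounded (hsumB y) (hb · y)
  -- The functionals for the errors `1 / (n + 1)` are normalised by their domination constants and
  -- summed with geometric weights.
  let φ : E →ₗ[ℝ] ℝ :=
    { toFun := fun y => ∑' n, (1 / 2 : ℝ) ^ n * ((C n + 1)⁻¹ * f n y)
      map_add' := fun y z => by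
        rw [← (hsum y).tsum_add (hsum z)]
        exact tsum_congr fun n => by rw [map_add]; ring
      map_smul' := fun c y => by
        rw [RingHom.id_apply, smul_eq_mul, ← tsum_mul_left]
        exact tsum_congr fun n => by rw [map_smul, smul_eq_mul]; ring }
  have hterm : ∀ n y, 0 ≤ y → 0 ≤ (1 / 2 : ℝ) ^ n * ((C n + 1)⁻¹ * f n y) := fun n y hy =>
    mul_nonneg (by positivity) (mul_nonneg (inv_nonneg.2 (by linarith [hC0 n])) (hf0 n y hy))
  refine ⟨φ, ⟨fun y hy => tsum_nonneg fun n => hterm n y hy, 2, zero_le_two, fun y => ?_⟩, ?_⟩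
  · have h1 : ‖∑' n, (1 / 2 : ℝ) ^ n * ((C n + 1)⁻¹ * f n y)‖ ≤
        ∑' n, (1 / 2 : ℝ) ^ n * bandNorm u y :=
      tsum_of_norm_bounded (hsumB y).hasSum (hb · y)
    rwa [tsum_mul_right, tsum_geometric_two] at h1
  · intro ε hε
    obtain ⟨n, hn⟩ := exists_nat_one_div_lt hε
    have hC1 : 0 < C n + 1 := by linarith [hC0 n]
    refine ⟨2 ^ n * (C n + 1), by positivity, fun x hx hxu => ?_⟩
    have h1 : (1 / 2 : ℝ) ^ n * ((C n + 1)⁻¹ * f n x) ≤ φ x :=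
      (hsum x).le_tsum n fun k _ => hterm k x hx
    have h2 := hfε n x hx hxu
    have h3 : f n x ≤ 2 ^ n * (C n + 1) * φ x := by
      calc f n x = 2 ^ n * (C n + 1) * ((1 / 2 : ℝ) ^ n * ((C n + 1)⁻¹ * f n x)) := by
            have : (2 : ℝ) ^ n * (1 / 2) ^ n = 1 := by rw [← mul_pow]; norm_num
            have h4 : (C n + 1) * (C n + 1)⁻¹ = 1 := mul_inv_cancel₀ hC1.ne'
            linear_combination (-(f n x) * ((C n + 1) * (C n + 1)⁻¹)) * this - (f n x) * h4
        _ ≤ _ := by gcongr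
    linarith

end Dominating

/-! ### Relative squares and the Hilbert seminorm of a positive functional. -/

section Square

variable {E : Type*} [NormedAddCommGroup E] [NormedSpace ℝ E] [Lattice E] [IsOrderedAddMonoid E]
  [IsOrderedModule ℝ E] [HasSolidNorm E]

/-- `a` is the square `x² / u` of `x` relative to the unit `u`. -/
def IsRelSquare (u x a : E) : Prop :=
  IsLUB (Set.range fun t : ℝ => (2 * t) • x - (t ^ 2) • u) a

theorem real_smul_le_abs (c : ℝ) (x : E) : c • x ≤ |c| • |x| := by
  rw [← abs_real_smul]; exact le_abs_self _

theorem two_mul_smul_sub_le {u x : E} (hu : 0 ≤ u) {M : ℝ} (hx : |x| ≤ M • u) (t : ℝ) :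
    (2 * t) • x - (t ^ 2) • u ≤ (M ^ 2) • u := by
  rw [sub_le_iff_le_add, ← add_smul]
  calc (2 * t) • x ≤ |2 * t| • |x| := real_smul_le_abs _ _
    _ ≤ |2 * t| • M • u := smul_le_smul_of_nonneg_left hx (abs_nonneg _)
    _ = (|2 * t| * M) • u := smul_smul _ _ _
    _ ≤ (M ^ 2 + t ^ 2) • u := by
      refine smul_le_smul_of_nonneg_right ?_ hu
      rw [abs_mul, abs_two]
      have := sq_nonneg (M - |t|)
      rw [← sq_abs t]
      nlinarith

theorem IsSigmaDedekindComplete.exists_isRelSquare (hE : IsSigmaDedekindComplete E) {u x : E}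
    (hu : 0 ≤ u) {M : ℝ} (hx : |x| ≤ M • u) : ∃ a, IsRelSquare u x a := by
  -- Only countable suprema are available; rational `t` suffice because the order is closed.
  obtain ⟨a, ha⟩ := hE (Set.range fun t : ℚ => (2 * (t : ℝ)) • x - ((t : ℝ) ^ 2) • u)
    (Set.range_nonempty _) (Set.countable_range _) ⟨(M ^ 2) • u, by
      rintro _ ⟨t, rfl⟩
      exact two_mul_smul_sub_le hu hx t⟩
  refine ⟨a, ?_, fun b hb => ha.2 ?_⟩
  · rintro _ ⟨t, rfl⟩
    refine Rat.denseRange_cast.induction_on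
      (p := fun t : ℝ => (2 * t) • x - (t ^ 2) • u ≤ a) t ?_ fun q => ha.1 ⟨q, rfl⟩
    exact isClosed_le (by fun_prop) continuous_const
  · rintro _ ⟨t, rfl⟩
    exact hb ⟨t, rfl⟩

variable {u x y a b c d : E}

theorem IsRelSquare.smul (hu : 0 ≤ u) (h : IsRelSquare u x a) (r : ℝ) :
    IsRelSquare u (r • x) ((r ^ 2) • a) := by
  rcases eq_or_ne r 0 with rfl | hr
  · have : (0 : ℝ) ^ 2 = 0 := by norm_num
    rw [this, zero_smul, zero_smul]
    refine ⟨?_, fun b hb => by simpa using hb ⟨0, rfl⟩⟩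
    rintro _ ⟨t, rfl⟩
    simpa using smul_nonneg (sq_nonneg t) hu
  · have hr2 : 0 < r ^ 2 := by positivity
    refine ⟨?_, fun b hb => ?_⟩
    · rintro _ ⟨t, rfl⟩
      have := smul_le_smul_of_nonneg_left (h.1 ⟨t / r, rfl⟩) hr2.le
      refine le_trans (le_of_eq ?_) this
      simp only
      rw [smul_sub, smul_smul, smul_smul, smul_smul]
      congr 2 <;> field_simp
    · have h1 : a ≤ (r ^ 2)⁻¹ • b := h.2 (by
        rintro _ ⟨t, rfl⟩
        have := smul_le_smul_of_nonneg_left (hb ⟨r * t, rfl⟩) (inv_pos.2 hr2).le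
        refine le_trans (le_of_eq ?_) this
        simp only
        rw [smul_sub, smul_smul, smul_smul, smul_smul]
        congr 2 <;> field_simp)
      have := smul_le_smul_of_nonneg_left h1 hr2.le
      rwa [smul_smul, mul_inv_cancel₀ hr2.ne', one_smul] at this

/-- The parameters `t`, `s` for `x`, `y` correspond to `t + s`, `t - s` for `x + y`, `x - y`, by an
exact identity. The reverse inequality is this one applied to `x + y` and `x - y`. -/
theorem IsRelSquare.two_smul_add_le (hx : IsRelSquare u x a) (hy : IsRelSquare u y b)
    (hadd : IsRelSquare u (x + y) c) (hsub : IsRelSquare u (x - y) d) :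
    (2 : ℝ) • a + (2 : ℝ) • b ≤ c + d := by
  have h1 : ∀ t s : ℝ, (2 : ℝ) • ((2 * t) • x - (t ^ 2) • u) +
      (2 : ℝ) • ((2 * s) • y - (s ^ 2) • u) ≤ c + d := fun t s => by
    refine le_trans (le_of_eq ?_) (add_le_add (hadd.1 ⟨t + s, rfl⟩) (hsub.1 ⟨t - s, rfl⟩))
    simp only
    module
  have h2 : ∀ s : ℝ, a ≤ (1 / 2 : ℝ) • (c + d) - ((2 * s) • y - (s ^ 2) • u) := fun s => hx.2 (by
    rintro _ ⟨t, rfl⟩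
    have := smul_le_smul_of_nonneg_left (h1 t s) (by norm_num : (0 : ℝ) ≤ 1 / 2)
    rw [le_sub_iff_add_le]
    refine le_trans (le_of_eq ?_) this
    simp only
    module)
  have h3 : b ≤ (1 / 2 : ℝ) • (c + d) - a := hy.2 (by
    rintro _ ⟨s, rfl⟩
    rw [le_sub_comm]
    exact h2 s)
  rw [le_sub_iff_add_le'] at h3
  have := smul_le_smul_of_nonneg_left h3 (by norm_num : (0 : ℝ) ≤ 2)
  rwa [smul_smul, mul_one_div_cancel two_ne_zero, one_smul, smul_add] at this

/-- The parallelogram law for relative squares. -/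
theorem IsRelSquare.parallelogram (hu : 0 ≤ u) (hx : IsRelSquare u x a) (hy : IsRelSquare u y b)
    (hadd : IsRelSquare u (x + y) c) (hsub : IsRelSquare u (x - y) d) :
    c + d = (2 : ℝ) • a + (2 : ℝ) • b := by
  refine le_antisymm ?_ (hx.two_smul_add_le hy hadd hsub)
  have h1 : IsRelSquare u ((x + y) + (x - y)) (((2 : ℝ) ^ 2) • a) := by
    have := hx.smul hu 2
    rwa [show (2 : ℝ) • x = (x + y) + (x - y) by module] at this
  have h2 : IsRelSquare u ((x + y) - (x - y)) (((2 : ℝ) ^ 2) • b) := by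
    have := hy.smul hu 2
    rwa [show (2 : ℝ) • y = (x + y) - (x - y) by module] at this
  have h3 := hadd.two_smul_add_le hsub h1 h2
  have := smul_le_smul_of_nonneg_left h3 (by norm_num : (0 : ℝ) ≤ 1 / 2)
  refine le_trans (le_of_eq ?_) (this.trans (le_of_eq ?_)) <;> module

theorem IsRelSquare.nonneg (h : IsRelSquare u x a) : 0 ≤ a := by
  simpa using h.1 ⟨0, rfl⟩

theorem IsRelSquare.le_of_abs_le (hu : 0 ≤ u) (h : IsRelSquare u x a) (hx : |x| ≤ u) : a ≤ u :=
  h.2 (by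
    rintro _ ⟨t, rfl⟩
    have := two_mul_smul_sub_le (M := 1) hu (by rwa [one_smul]) t
    rwa [one_pow, one_smul] at this)

theorem IsRelSquare.abs_le (h : IsRelSquare u x a) {t : ℝ} (ht : 0 ≤ t) :
    (2 * t) • |x| ≤ a + (t ^ 2) • u := by
  have : (2 * t) • |x| = |(2 * t) • x| := by
    rw [abs_real_smul, abs_of_nonneg (by positivity : 0 ≤ 2 * t)]
  rw [this]
  refine abs_le'.2 ⟨?_, ?_⟩
  · rw [← sub_le_iff_le_add]; exact h.1 ⟨t, rfl⟩
  · rw [← sub_le_iff_le_add]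
    refine le_trans (le_of_eq ?_) (h.1 ⟨-t, rfl⟩)
    simp only
    module

/-- This is `(x + y)² / (r + s) ≤ x² / r + y² / s`, from splitting `t` in proportion `r : s`.
Optimising `r` and `s` after applying a positive functional gives the triangle inequality. -/
theorem IsRelSquare.add_le (hx : IsRelSquare u x a) (hy : IsRelSquare u y b)
    (hadd : IsRelSquare u (x + y) c) {r s : ℝ} (hr : 0 < r) (hs : 0 < s) :
    c ≤ ((r + s) / r) • a + ((r + s) / s) • b := hadd.2 (by
  rintro _ ⟨t, rfl⟩
  have h1 := smul_le_smul_of_nonneg_left (hx.1 ⟨t * (r / (r + s)), rfl⟩)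
    (by positivity : 0 ≤ (r + s) / r)
  have h2 := smul_le_smul_of_nonneg_left (hy.1 ⟨t * (s / (r + s)), rfl⟩)
    (by positivity : 0 ≤ (r + s) / s)
  refine le_trans (le_of_eq ?_) (add_le_add h1 h2)
  simp only [smul_sub, smul_smul, smul_add]
  have hrs : r + s ≠ 0 := by positivity
  have e1 : (r + s) / r * (2 * (t * (r / (r + s)))) = 2 * t := by field_simp
  have e2 : (r + s) / s * (2 * (t * (s / (r + s)))) = 2 * t := by field_simp
  have e3 : (r + s) / r * (t * (r / (r + s))) ^ 2 + (r + s) / s * (t * (s / (r + s))) ^ 2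
      = t ^ 2 := by field_simp
  rw [e1, e2, ← e3, add_smul]
  abel)

/-- The principal ideal generated by `u`. -/
def principalIdeal (u : E) : Submodule ℝ E where
  carrier := {x | ∃ M : ℝ, 0 ≤ M ∧ |x| ≤ M • u}
  zero_mem' := ⟨0, le_rfl, by simp⟩
  add_mem' := fun {x y} ⟨M, hM, hx⟩ ⟨N, hN, hy⟩ => ⟨M + N, add_nonneg hM hN, by
    rw [add_smul]; exact (abs_add_le x y).trans (add_le_add hx hy)⟩
  smul_mem' := fun c x ⟨M, hM, hx⟩ => ⟨|c| * M, mul_nonneg (abs_nonneg c) hM, by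
    rw [abs_real_smul, mul_smul]; exact smul_le_smul_of_nonneg_left hx (abs_nonneg c)⟩

/-- A positive functional induces a Hilbert seminorm on a principal ideal. -/
theorem IsSigmaDedekindComplete.exists_hilbert_seminorm (hE : IsSigmaDedekindComplete E)
    (hu : 0 ≤ u) {φ : E →ₗ[ℝ] ℝ} (hφ : ∀ x, 0 ≤ x → 0 ≤ φ x) :
    ∃ p : Seminorm ℝ (principalIdeal u),
      (∀ x y, p (x + y) ^ 2 + p (x - y) ^ 2 = 2 * (p x ^ 2 + p y ^ 2)) ∧
      (∀ x : principalIdeal u, |(x : E)| ≤ u → p x ≤ √(φ u)) ∧ ∀ x : principalIdeal u, φ |(x : E)| ≤ √(φ u) * p x := by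
  have hex : ∀ x : principalIdeal u, ∃ a, IsRelSquare u (x : E) a := fun x => by
    obtain ⟨M, -, hx⟩ := x.2
    exact hE.exists_isRelSquare hu hx
  choose Q hQ using hex
  set q : principalIdeal u → ℝ := fun x => φ (Q x) with hq
  have hq0 : ∀ x, 0 ≤ q x := fun x => hφ _ (hQ x).nonneg
  have hqsmul : ∀ (r : ℝ) x, q (r • x) = r ^ 2 * q x := fun r x => by
    have : Q (r • x) = (r ^ 2) • Q x := (hQ (r • x)).unique ((hQ x).smul hu r)
    rw [hq]; simp only; rw [this, map_smul, smul_eq_mul]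
  have hqadd : ∀ x y, √(q (x + y)) ≤ √(q x) + √(q y) := fun x y => by
    refine le_of_forall_pos_le_add fun ε hε => ?_
    set r := √(q x) + ε / 2 with hr
    set s := √(q y) + ε / 2 with hs
    have hr0 : 0 < r := by positivity
    have hs0 : 0 < s := by positivity
    have h1 : q x ≤ r ^ 2 := by
      calc q x = √(q x) ^ 2 := (Real.sq_sqrt (hq0 x)).symm
        _ ≤ r ^ 2 := by gcongr; linarith
    have h2 : q y ≤ s ^ 2 := by
      calc q y = √(q y) ^ 2 := (Real.sq_sqrt (hq0 y)).symm
        _ ≤ s ^ 2 := by gcongr; linarith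
    have h3 : q (x + y) ≤ (r + s) / r * q x + (r + s) / s * q y := by
      have := LinearMap.mono_of_nonneg hφ ((hQ x).add_le (hQ y) (hQ (x + y)) hr0 hs0)
      rwa [map_add, map_smul, map_smul, smul_eq_mul, smul_eq_mul] at this
    have h4 : q (x + y) ≤ (r + s) ^ 2 := by
      calc q (x + y) ≤ (r + s) / r * r ^ 2 + (r + s) / s * s ^ 2 := h3.trans (by gcongr)
        _ = (r + s) ^ 2 := by field_simp
    calc √(q (x + y)) ≤ r + s := (Real.sqrt_le_sqrt h4).trans (Real.sqrt_sq (by positivity)).le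
      _ = √(q x) + √(q y) + ε := by rw [hr, hs]; ring
  refine ⟨Seminorm.of (fun x => √(q x)) hqadd fun r x => ?_, fun x y => ?_, fun x hx => ?_,
    fun x => ?_⟩
  · rw [hqsmul, Real.sqrt_mul (sq_nonneg r), Real.sqrt_sq_eq_abs, Real.norm_eq_abs]
  · change √(q (x + y)) ^ 2 + √(q (x - y)) ^ 2 = 2 * (√(q x) ^ 2 + √(q y) ^ 2)
    simp only [Real.sq_sqrt (hq0 _)]
    have := congrArg φ ((hQ x).parallelogram hu (hQ y) (hQ (x + y)) (hQ (x - y)))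
    rw [map_add, map_add, map_smul, map_smul, smul_eq_mul, smul_eq_mul] at this
    rw [hq]
    simp only
    linarith
  · exact Real.sqrt_le_sqrt (LinearMap.mono_of_nonneg hφ ((hQ x).le_of_abs_le hu hx))
  · change φ |(x : E)| ≤ √(φ u) * √(q x)
    rw [← Real.sqrt_mul (hφ u hu)]
    have hφx : 0 ≤ φ |(x : E)| := hφ _ (abs_nonneg _)
    refine Real.le_sqrt_of_sq_le ?_
    have key : ∀ t : ℝ, 0 ≤ t → 2 * t * φ |(x : E)| ≤ q x + t ^ 2 * φ u := fun t ht => by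
      have := LinearMap.mono_of_nonneg hφ ((hQ x).abs_le ht)
      rwa [map_add, map_smul, map_smul, smul_eq_mul, smul_eq_mul] at this
    -- Cauchy–Schwarz by optimising `t` in `key`; when `φ u = 0`, a large `t` forces `φ |x| = 0`.
    rcases (hφ u hu).eq_or_lt with h0 | h0
    · rw [← h0, zero_mul]
      by_contra hcon
      have hpos : 0 < φ |(x : E)| := lt_of_le_of_ne hφx fun h => hcon (by rw [← h]; norm_num)
      have := key ((q x + 1) / φ |(x : E)|) (div_nonneg (by linarith [hq0 x]) hφx)
      rw [← h0, mul_zero, mul_assoc, div_mul_cancel₀ _ hpos.ne'] at this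
      linarith [hq0 x]
    · have := key (φ |(x : E)| / φ u) (div_nonneg hφx h0.le)
      have h1 : 2 * (φ |(x : E)| / φ u) * φ |(x : E)| = 2 * (φ |(x : E)| ^ 2 / φ u) := by ring
      have h2 : (φ |(x : E)| / φ u) ^ 2 * φ u = φ |(x : E)| ^ 2 / φ u := by field_simp
      rw [h1, h2] at this
      have h3 : φ |(x : E)| ^ 2 / φ u ≤ q x := by linarith
      rwa [div_le_iff₀ h0, mul_comm] at h3

end Square

/-! ### Norm compactness of order intervals. -/

section Subsequences

variable {E : Type*} [NormedAddCommGroup E] [NormedSpace ℝ E] [Lattice E] [IsOrderedAddMonoid E]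
  [IsOrderedModule ℝ E] [HasSolidNorm E]

theorem mem_principalIdeal_of_abs_le {u x : E} (hx : |x| ≤ u) : x ∈ principalIdeal u :=
  ⟨1, zero_le_one, by rwa [one_smul]⟩

/-- Sequences in an order interval have subsequences that are Cauchy for every functional dominated
by a multiple of a given positive functional. -/
theorem IsSigmaDedekindComplete.exists_subseq_cauchySeq_apply (hE : IsSigmaDedekindComplete E)
    {u : E} (hu : 0 ≤ u) {φ : E →ₗ[ℝ] ℝ} (hφ : ∀ x, 0 ≤ x → 0 ≤ φ x) {x : ℕ → E}
    (hx : ∀ n, |x n| ≤ u) : ∃ θ : ℕ → ℕ, StrictMono θ ∧ ∀ (f : E →ₗ[ℝ] ℝ) (C : ℝ), 0 ≤ C →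
      (∀ y, |f y| ≤ C * φ |y|) → CauchySeq fun n => f (x (θ n)) := by
  obtain ⟨p, hp, hpu, hφp⟩ := hE.exists_hilbert_seminorm hu hφ
  obtain ⟨H, _, _, _, J, hJ, hJf⟩ := p.exists_hilbert hp
  let v : ℕ → principalIdeal u := fun n => ⟨x n, mem_principalIdeal_of_abs_le (hx n)⟩
  obtain ⟨θ, hθ, hc⟩ := exists_subseq_forall_cauchySeq_inner (ξ := fun n => J (v n))
    (M := √(φ u)) fun n => by rw [hJ]; exact hpu _ (hx n)
  refine ⟨θ, hθ, fun f C hC hf => ?_⟩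
  obtain ⟨g, -, hg⟩ := hJf (f ∘ₗ (principalIdeal u).subtype) (C * √(φ u)) (by positivity)
    fun y => (hf y).trans (by rw [mul_assoc]; exact mul_le_mul_of_nonneg_left (hφp y) hC)
  have hfg : (fun n => f (x (θ n))) = fun n => inner ℝ (J (v (θ n))) g := funext fun n => by
    rw [real_inner_comm]
    exact hg (v (θ n))
  rw [hfg]
  exact hc g

theorem cauchySeq_of_forall_exists_near {a : ℕ → ℝ}
    (h : ∀ ε > 0, ∃ b : ℕ → ℝ, CauchySeq b ∧ ∀ n, |a n - b n| ≤ ε) : CauchySeq a := by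
  rw [Metric.cauchySeq_iff']
  intro ε hε
  obtain ⟨b, hb, hab⟩ := h (ε / 4) (by positivity)
  obtain ⟨N, hN⟩ := Metric.cauchySeq_iff'.1 hb (ε / 4) (by positivity)
  refine ⟨N, fun n hn => ?_⟩
  have h1 := hN n hn
  have h2 := hab n
  have h3 := hab N
  rw [Real.dist_eq] at h1 ⊢
  rw [abs_lt] at *
  rw [abs_le] at h2 h3
  constructor <;> linarith [h1.1, h1.2, h2.1, h2.2, h3.1, h3.2]

/-- The remainder truncated at `k u` lies below `x ⊓ (m + k) u - x ⊓ m u`, which is a Cauchy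
increment. -/
theorem MonotoneSeqCauchy.exists_bandNorm_sub_le (hS : MonotoneSeqCauchy E) {u : E} (hu : 0 ≤ u)
    (x : E) {ε : ℝ} (hε : 0 < ε) : ∃ m : ℕ, bandNorm u (x - x ⊓ (m : ℝ) • u) ≤ ε := by
  have hmono : Monotone fun m : ℕ => x ⊓ (m : ℝ) • u := fun m n h =>
    inf_le_inf_left _ (smul_le_smul_of_nonneg_right (Nat.cast_le.2 h) hu)
  have hc := hS _ hmono ⟨x, by rintro _ ⟨m, rfl⟩; exact inf_le_left⟩
  obtain ⟨m, hm⟩ := Metric.cauchySeq_iff'.1 hc ε hε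
  refine ⟨m, ciSup_le fun k => ?_⟩
  have h0 : 0 ≤ x - x ⊓ (m : ℝ) • u := sub_nonneg.2 inf_le_left
  have h1 := hm (m + k) (by omega)
  rw [dist_eq_norm] at h1
  refine le_trans (norm_le_norm_of_nonneg_of_le (abs_inf_smul_nonneg _ _ k.cast_nonneg) ?_) h1.le
  rw [abs_of_nonneg h0, abs_of_nonneg hu, le_sub_iff_add_le]
  refine le_inf ?_ ?_
  · calc (x - x ⊓ (m : ℝ) • u) ⊓ (k : ℝ) • u + x ⊓ (m : ℝ) • u
        ≤ (x - x ⊓ (m : ℝ) • u) + x ⊓ (m : ℝ) • u := by gcongr; exact inf_le_left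
      _ = x := by abel
  · rw [Nat.cast_add, add_smul, add_comm ((m : ℝ) • u)]
    exact add_le_add inf_le_right inf_le_right

/-- Sequences of functionals dominated by a positive functional that is carried by a principal band
have pointwise Cauchy subsequences. -/
theorem MonotoneSeqCauchy.exists_subseq_cauchySeq_functional [CompleteSpace E]
    (hS : MonotoneSeqCauchy E) {u : E} (hu : 0 ≤ u) {φ : E →ₗ[ℝ] ℝ} (hφ : IsBandDominated u φ)
    {f : ℕ → E →ₗ[ℝ] ℝ} (hf : ∀ n y, |f n y| ≤ φ |y|) :
    ∃ θ : ℕ → ℕ, StrictMono θ ∧ ∀ y, CauchySeq fun n => f (θ n) y := by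
  obtain ⟨p, hp, hpu, hφp⟩ := hS.isSigmaDedekindComplete.exists_hilbert_seminorm hu hφ.1
  obtain ⟨H, _, _, _, J, hJ, hJf⟩ := p.exists_hilbert hp
  choose g hg1 hg2 using fun n => hJf (f n ∘ₗ (principalIdeal u).subtype) (√(φ u))
    (Real.sqrt_nonneg _) fun y => (hf n y).trans (hφp y)
  obtain ⟨θ, hθ, hc⟩ := exists_subseq_forall_cauchySeq_inner hg1
  refine ⟨θ, hθ, ?_⟩
  have hideal : ∀ y ∈ principalIdeal u, CauchySeq fun n => f (θ n) y := fun y hy => by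
    have hfg : (fun n => f (θ n) y) = fun n => inner ℝ (g (θ n)) (J ⟨y, hy⟩) :=
      funext fun n => hg2 (θ n) ⟨y, hy⟩
    rw [hfg]
    exact hc _
  obtain ⟨-, C, hC0, hC⟩ := hφ
  -- Truncations of `y` lie in the ideal of `u` and approximate `y` in the band norm that dominates
  -- `φ`.
  have hpos : ∀ y, 0 ≤ y → CauchySeq fun n => f (θ n) y := fun y hy => by
    refine cauchySeq_of_forall_exists_near fun ε hε => ?_
    obtain ⟨m, hm⟩ := hS.exists_bandNorm_sub_le hu y (ε := ε / (C + 1)) (by positivity)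
    refine ⟨fun n => f (θ n) (y ⊓ (m : ℝ) • u), hideal _ ⟨m, m.cast_nonneg, ?_⟩, fun n => ?_⟩
    · rw [abs_of_nonneg (le_inf hy (smul_nonneg m.cast_nonneg hu))]
      exact inf_le_right
    · rw [← map_sub]
      refine (hf _ _).trans ((le_abs_self _).trans ((hC _).trans ?_))
      rw [(bandNorm_isSolid u).abs_eq]
      calc C * bandNorm u (y - y ⊓ (m : ℝ) • u) ≤ C * (ε / (C + 1)) := by gcongr
        _ ≤ (C + 1) * (ε / (C + 1)) := by gcongr; linarith
        _ = ε := by field_simp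
  intro y
  obtain ⟨l, hl⟩ := cauchySeq_tendsto_of_complete (hpos _ (posPart_nonneg y))
  obtain ⟨l', hl'⟩ := cauchySeq_tendsto_of_complete (hpos _ (negPart_nonneg y))
  refine Tendsto.cauchySeq (x := l - l') ((hl.sub hl').congr fun n => ?_)
  rw [← map_sub, posPart_sub_negPart]

/-- The seminorm `x ↦ φ |x|` of a positive functional `φ`. -/
noncomputable def absSeminorm (φ : E →ₗ[ℝ] ℝ) (hφ : ∀ x, 0 ≤ x → 0 ≤ φ x) : Seminorm ℝ E :=
  Seminorm.of (fun x => φ |x|)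
    (fun x y => by
      rw [← map_add]; exact LinearMap.mono_of_nonneg hφ (abs_add_le x y))
    (fun c x => by rw [abs_real_smul, map_smul, smul_eq_mul, Real.norm_eq_abs])

/-- Every weak-star null sequence of functionals tends to zero along order bounded sequences. -/
def OrderIntervalsLimited (E : Type*) [NormedAddCommGroup E] [NormedSpace ℝ E] [Lattice E] : Prop :=
  ∀ u : E, ∀ h : ℕ → StrongDual ℝ E, WeakStarNull h → ∀ w : ℕ → E, (∀ n, |w n| ≤ u) →
    Tendsto (fun n => h n (w n)) atTop (𝓝 0)

/-- Choose `f n`, dominated by `φ`, attaining `φ |y n|` at `y n` along a subsequence. A further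
subsequence converges pointwise to some `F`; limitedness handles `f n - F` and the hypothesis on `y`
handles `F`. -/
theorem OrderIntervalsLimited.tendsto_apply_abs [CompleteSpace E] (hL : OrderIntervalsLimited E)
    (hS : MonotoneSeqCauchy E) {u : E} (hu : 0 ≤ u) {φ : E →ₗ[ℝ] ℝ} (hφ : IsBandDominated u φ)
    {y : ℕ → E} (hy : ∀ n, |y n| ≤ u)
    (hy0 : ∀ (f : E →ₗ[ℝ] ℝ) (C : ℝ), 0 ≤ C → (∀ x, |f x| ≤ C * φ |x|) →
      Tendsto (fun n => f (y n)) atTop (𝓝 0)) : Tendsto (fun n => φ |y n|) atTop (𝓝 0) := by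
  by_contra hcon
  obtain ⟨δ, hδ, τ, hτ, hδy⟩ := exists_subseq_of_not_tendsto_zero hcon
  choose f hf1 hf2 using fun n => (absSeminorm φ hφ.1).exists_linearMap_abs_le_eq (y (τ n))
  have hf1' : ∀ n x, |f n x| ≤ φ |x| := hf1
  have hf2' : ∀ n, f n (y (τ n)) = φ |y (τ n)| := hf2
  obtain ⟨θ, hθ, hc⟩ := hS.exists_subseq_cauchySeq_functional hu hφ hf1'
  choose l hl using fun x => cauchySeq_tendsto_of_complete (hc x)
  let F : E →ₗ[ℝ] ℝ :=
    { toFun := l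
      map_add' := fun a b => tendsto_nhds_unique (hl (a + b))
        (by simpa only [map_add] using (hl a).add (hl b))
      map_smul' := fun c a => tendsto_nhds_unique (hl (c • a))
        (by simpa only [map_smul, smul_eq_mul, RingHom.id_apply] using (hl a).const_mul c) }
  have hF : ∀ x, |F x| ≤ φ |x| := fun x => le_of_tendsto' (hl x).abs fun n => hf1' _ x
  obtain ⟨C, hC0, hC⟩ := hφ.2
  have hφb : ∀ x, φ |x| ≤ C * ‖x‖ := fun x => by
    refine (le_abs_self _).trans ((hC _).trans ?_)
    rw [(bandNorm_isSolid u).abs_eq]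
    exact mul_le_mul_of_nonneg_left (bandNorm_le u x) hC0
  have hdiff : ∀ n x, |(f (θ n) - F) x| ≤ (2 * C) * ‖x‖ := fun n x => by
    rw [LinearMap.sub_apply]
    have h1 := abs_sub (f (θ n) x) (F x)
    have h2 := hf1' (θ n) x
    have h3 := hF x
    have h4 := hφb x
    linarith
  have h1 := hL u (fun n => (f (θ n) - F).mkContinuous (2 * C) (hdiff n))
    (weakStarNull_iff.2 fun x => by
      have := (hl x).sub_const (l x)
      rwa [sub_self] at this) (fun n => y (τ (θ n))) fun n => hy _
  have h2 := (hy0 F 1 zero_le_one fun x => by rw [one_mul]; exact hF x).comp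
    (hτ.tendsto_atTop.comp hθ.tendsto_atTop)
  have h3 := h1.add h2
  rw [add_zero] at h3
  have h4 : ∀ n, δ ≤ (f (θ n) - F).mkContinuous (2 * C) (hdiff n) (y (τ (θ n))) +
      ((fun n => F (y n)) ∘ τ ∘ θ) n := fun n => by
    change δ ≤ (f (θ n) (y (τ (θ n))) - F (y (τ (θ n)))) + F (y (τ (θ n)))
    rw [sub_add_cancel, hf2']
    have := hδy (θ n)
    rwa [abs_of_nonneg (hφ.1 _ (abs_nonneg _))] at this
  have := ge_of_tendsto' h3 h4
  linarith

theorem tendsto_zero_of_apply_abs {u : E} {φ : E →ₗ[ℝ] ℝ}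
    (hc : ∀ ε > 0, ∃ C : ℝ, 0 ≤ C ∧ ∀ x, 0 ≤ x → x ≤ u → ‖x‖ ≤ C * φ x + ε) {y : ℕ → E}
    (hy : ∀ n, |y n| ≤ u) (h : Tendsto (fun n => φ |y n|) atTop (𝓝 0)) :
    Tendsto y atTop (𝓝 0) := by
  rw [tendsto_zero_iff_norm_tendsto_zero, Metric.tendsto_atTop]
  intro ε hε
  obtain ⟨C, hC0, hC⟩ := hc (ε / 2) (by positivity)
  have h1 := h.const_mul C
  rw [mul_zero] at h1
  obtain ⟨N, hN⟩ := eventually_atTop.1 (h1.eventually (gt_mem_nhds (by positivity : 0 < ε / 2)))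
  refine ⟨N, fun n hn => ?_⟩
  rw [Real.dist_eq, sub_zero, abs_norm, ← norm_abs_eq_norm]
  have := hC _ (abs_nonneg (y n)) (hy n)
  have := hN n hn
  linarith

/-- A sequence in an order interval that is null for all functionals dominated by a control
functional is weakly null. -/
theorem weaklyNull_of_control {u : E} {φ : E →ₗ[ℝ] ℝ} (hφ : ∀ x, 0 ≤ x → 0 ≤ φ x)
    (hc : ∀ ε > 0, ∃ C : ℝ, 0 ≤ C ∧ ∀ x, 0 ≤ x → x ≤ u → ‖x‖ ≤ C * φ x + ε) {y : ℕ → E}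
    (hy : ∀ n, |y n| ≤ u)
    (hy0 : ∀ (f : E →ₗ[ℝ] ℝ) (C : ℝ), 0 ≤ C → (∀ x, |f x| ≤ C * φ |x|) →
      Tendsto (fun n => f (y n)) atTop (𝓝 0)) : WeaklyNull y := by
  refine weaklyNull_iff.2 fun ψ => ?_
  by_contra hcon
  obtain ⟨η, hη, τ, hτ, hηy⟩ := exists_subseq_of_not_tendsto_zero hcon
  have hσ : ∀ n, ∃ c : ℝ, |c| = 1 ∧ |ψ (y (τ n))| = c * ψ (y (τ n)) := fun n => by
    rcases abs_choice (ψ (y (τ n))) with h | h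
    · exact ⟨1, by simp, by rw [h, one_mul]⟩
    · exact ⟨-1, by simp, by rw [h, neg_one_mul]⟩
  choose c hc1 hc2 using hσ
  obtain ⟨C, hC0, hC⟩ := hc (η / (4 * (‖ψ‖ + 1))) (by positivity)
  -- By Mazur, a convex combination `z` of signed terms has small `φ |z|`, hence small norm by
  -- control, while still `ψ z ≥ η`.
  obtain ⟨z, hz, hzlt⟩ := (absSeminorm φ hφ).exists_mem_convexHull_lt
    (v := fun n => c n • y (τ n)) (fun f D hf => by
      have h1 := (hy0 f (max D 0) (le_max_right _ _) fun x => (hf x).trans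
        (mul_le_mul_of_nonneg_right (le_max_left _ _) (hφ _ (abs_nonneg x)))).comp hτ.tendsto_atTop
      refine squeeze_zero_norm (fun n => ?_) (by simpa using h1.norm)
      rw [map_smul, smul_eq_mul, norm_mul, Real.norm_eq_abs, hc1, one_mul]
      exact le_rfl)
    (ε := η / (4 * (‖ψ‖ + 1) * (C + 1))) (by positivity)
  have hconv : Convex ℝ {z : E | |z| ≤ u ∧ η ≤ ψ z} := by
    rintro a ⟨ha1, ha2⟩ b ⟨hb1, hb2⟩ r s hr hs hrs
    refine ⟨(abs_add_le _ _).trans ?_, ?_⟩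
    · rw [abs_real_smul, abs_real_smul, abs_of_nonneg hr, abs_of_nonneg hs]
      calc r • |a| + s • |b| ≤ r • u + s • u :=
            add_le_add (smul_le_smul_of_nonneg_left ha1 hr) (smul_le_smul_of_nonneg_left hb1 hs)
        _ = u := by rw [← add_smul, hrs, one_smul]
    · rw [map_add, map_smul, map_smul, smul_eq_mul, smul_eq_mul]
      calc η = r * η + s * η := by rw [← add_mul, hrs, one_mul]
        _ ≤ _ := by gcongr
  obtain ⟨hzu, hzη⟩ := convexHull_min (by
    rintro _ ⟨n, rfl⟩
    refine ⟨?_, ?_⟩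
    · change |c n • y (τ n)| ≤ u
      rw [abs_real_smul, hc1, one_smul]; exact hy _
    · rw [map_smul, smul_eq_mul, ← hc2]; exact hηy n) hconv hz
  have h1 := hC _ (abs_nonneg z) hzu
  rw [norm_abs_eq_norm] at h1
  have h2 : C * φ |z| ≤ η / (4 * (‖ψ‖ + 1)) := by
    have h3 : φ |z| < η / (4 * (‖ψ‖ + 1) * (C + 1)) := hzlt
    calc C * φ |z| ≤ (C + 1) * (η / (4 * (‖ψ‖ + 1) * (C + 1))) := by
          gcongr
          · exact hφ _ (abs_nonneg z)
          · linarith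
      _ = η / (4 * (‖ψ‖ + 1)) := by field_simp
  have h4 : η ≤ ‖ψ‖ * ‖z‖ := hzη.trans ((le_abs_self _).trans (ψ.le_opNorm z))
  have h5 : ‖ψ‖ * ‖z‖ ≤ (‖ψ‖ + 1) * (2 * (η / (4 * (‖ψ‖ + 1)))) := by
    gcongr
    · linarith
    · linarith
  have h6 : (‖ψ‖ + 1) * (2 * (η / (4 * (‖ψ‖ + 1)))) = η / 2 := by field_simp; norm_num
  linarith

/-- Every order bounded sequence has a norm convergent subsequence. -/
def OrderIntervalsCompact (E : Type*) [NormedAddCommGroup E] [Lattice E] : Prop :=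
  ∀ (u : E) (x : ℕ → E), (∀ n, |x n| ≤ u) →
    ∃ θ : ℕ → ℕ, StrictMono θ ∧ ∃ L, Tendsto (fun n => x (θ n)) atTop (𝓝 L)

/-- Differences of terms range over `[-2u, 2u]`, so control is needed for `2u`. Along a subsequence
they are null for all functionals dominated by `φ`; either alternative turns this into norm nullity.
-/
theorem MonotoneSeqCauchy.orderIntervalsCompact [CompleteSpace E] (hS : MonotoneSeqCauchy E)
    (h : OrderIntervalsLimited E ∨ HasSchurProperty E) : OrderIntervalsCompact E := by
  intro u x hx
  have hu : 0 ≤ u := (abs_nonneg _).trans (hx 0)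
  have hu2 : 0 ≤ (2 : ℝ) • u := smul_nonneg zero_le_two hu
  obtain ⟨φ, hφ, hc⟩ := hS.exists_control hu2
  obtain ⟨θ, hθ, hθc⟩ := hS.isSigmaDedekindComplete.exists_subseq_cauchySeq_apply hu hφ.1 hx
  refine ⟨θ, hθ, cauchySeq_tendsto_of_complete
    (cauchySeq_of_subseq_sub_tendsto_zero fun τ hτ => ?_)⟩
  have hy : ∀ k, |x (θ (τ (k + 1))) - x (θ (τ k))| ≤ (2 : ℝ) • u := fun k => by
    rw [two_smul, sub_eq_add_neg]
    refine (abs_add_le _ _).trans (add_le_add (hx _) ?_)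
    rw [abs_neg]
    exact hx _
  have hy0 : ∀ (f : E →ₗ[ℝ] ℝ) (C : ℝ), 0 ≤ C → (∀ x, |f x| ≤ C * φ |x|) →
      Tendsto (fun k => f (x (θ (τ (k + 1))) - x (θ (τ k)))) atTop (𝓝 0) := fun f C hC0 hC => by
    obtain ⟨l, hl⟩ := cauchySeq_tendsto_of_complete (hθc f C hC0 hC)
    have h1 := hl.comp hτ.tendsto_atTop
    have h2 := (h1.comp (tendsto_add_atTop_nat 1)).sub h1
    rw [sub_self] at h2
    exact h2.congr fun k => (map_sub f _ _).symm
  rcases h with h | h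
  · exact tendsto_zero_of_apply_abs hc hy (h.tendsto_apply_abs hS hu2 hφ hy hy0)
  · exact h _ (weaklyNull_of_control hφ.1 hc hy hy0)

end Subsequences

/-! ### Limited sets in terms of sequences. -/

section Limited

variable {X : Type*} [NormedAddCommGroup X] [NormedSpace ℝ X]

theorem IsLimitedSet.tendsto_apply {A : Set X} (hA : IsLimitedSet A) {f : ℕ → StrongDual ℝ X}
    (hf : WeakStarNull f) {x : ℕ → X} (hx : ∀ n, x n ∈ A) :
    Tendsto (fun n => f n (x n)) atTop (𝓝 0) := by
  rw [Metric.tendsto_atTop]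
  intro ε hε
  obtain ⟨N, hN⟩ := eventually_atTop.1 (Metric.tendstoUniformlyOn_iff.1 (hA.2 f hf) ε hε)
  refine ⟨N, fun n hn => ?_⟩
  rw [dist_comm]
  exact hN n hn _ (hx n)

theorem isLimitedSet_of_tendsto_apply {A : Set X} (hA : Bornology.IsBounded A)
    (h : ∀ f : ℕ → StrongDual ℝ X, WeakStarNull f → ∀ x : ℕ → X, (∀ n, x n ∈ A) →
      Tendsto (fun n => f n (x n)) atTop (𝓝 0)) : IsLimitedSet A := by
  refine ⟨hA, fun f hf => ?_⟩
  rcases A.eq_empty_or_nonempty with rfl | ⟨a, ha⟩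
  · exact tendstoUniformlyOn_empty
  rw [Metric.tendstoUniformlyOn_iff]
  intro ε hε
  -- `x n` violates the bound whenever some point of `A` does; otherwise it defaults to `a`.
  have hx : ∀ n, ∃ x ∈ A, (∃ z ∈ A, ¬ dist 0 (f n z) < ε) → ¬ dist 0 (f n x) < ε := fun n => by
    by_cases h' : ∃ z ∈ A, ¬ dist 0 (f n z) < ε
    · obtain ⟨z, hz, hzε⟩ := h'
      exact ⟨z, hz, fun _ => hzε⟩
    · exact ⟨a, ha, fun h'' => absurd h'' h'⟩
  choose x hxA hx using hx
  filter_upwards [(h f hf x hxA).eventually (Metric.ball_mem_nhds 0 hε)] with n hn z hz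
  by_contra hcon
  refine hx n ⟨z, hz, hcon⟩ ?_
  rw [dist_comm]
  exact hn

end Limited

/-! ### The Schur property and (d)-DP*. -/

section Main

variable {E : Type*} [NormedAddCommGroup E] [NormedSpace ℝ E] [Lattice E] [IsOrderedAddMonoid E]
  [IsOrderedModule ℝ E] [HasSolidNorm E]

theorem isBounded_solidClosure {A : Set E} (hA : Bornology.IsBounded A) :
    Bornology.IsBounded (LatticeOrderedAddCommGroup.solidClosure A) := by
  obtain ⟨C, hC⟩ := hA.exists_norm_le
  refine isBounded_iff_forall_norm_le.2 ⟨C, ?_⟩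
  rintro y ⟨x, hx, hxy⟩
  exact (norm_le_norm_of_abs_le_abs hxy).trans (hC x hx)

theorem solidClosure_solidClosure_subset (A : Set E) :
    LatticeOrderedAddCommGroup.solidClosure (LatticeOrderedAddCommGroup.solidClosure A) ⊆
      LatticeOrderedAddCommGroup.solidClosure A := by
  rintro z ⟨y, ⟨x, hx, hyx⟩, hzy⟩
  exact ⟨x, hx, hzy.trans hyx⟩

theorem isDisjointlyWeaklyCompact_orderInterval (u : E) :
    IsDisjointlyWeaklyCompact {x : E | |x| ≤ u} := by
  refine ⟨isBounded_iff_forall_norm_le.2 ⟨‖u‖, fun x hx => norm_le_norm_of_abs_le hx⟩,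
    fun y hy hd => hd.weaklyNull_of_abs_le (u := u) fun n => ?_⟩
  obtain ⟨x, hx, hyx⟩ := hy n
  exact hyx.trans hx

theorem HasDDPStarProperty.orderIntervalsLimited (h : HasDDPStarProperty E) :
    OrderIntervalsLimited E := fun u _ hf _ hw =>
  (h _ (isDisjointlyWeaklyCompact_orderInterval u)).tendsto_apply hf hw

/-- The Schur property makes disjoint sequences in the solid hull norm null, so points of `A` are
truncated into a compact order interval with small error. The error is harmless because `f` is norm
bounded by Banach–Steinhaus. -/
theorem HasSchurProperty.hasDDPStarProperty [CompleteSpace E] (h : HasSchurProperty E) :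
    HasDDPStarProperty E := by
  intro A hA
  refine isLimitedSet_of_tendsto_apply hA.1 fun f hf x hx => ?_
  obtain ⟨M, hM⟩ : ∃ M, ∀ n, ‖f n‖ ≤ M := banach_steinhaus fun y => by
    obtain ⟨C, hC⟩ := isBounded_iff_forall_norm_le.1
      (Metric.isBounded_range_of_tendsto _ (weakStarNull_iff.1 hf y))
    exact ⟨C, fun n => hC _ ⟨n, rfl⟩⟩
  have hM0 : 0 ≤ M := (norm_nonneg _).trans (hM 0)
  have hcompact := h.monotoneSeqCauchy.orderIntervalsCompact (Or.inr h)
  have hord : ∀ (u : E) (a : ℕ → E), (∀ n, |a n| ≤ u) →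
      Tendsto (fun n => f n (a n)) atTop (𝓝 0) := fun u a ha => by
    by_contra hcon
    obtain ⟨δ, hδ, τ, hτ, hδa⟩ := exists_subseq_of_not_tendsto_zero hcon
    obtain ⟨θ, hθ, L, hL⟩ := hcompact u (a ∘ τ) fun n => ha _
    have h1 := ((weakStarNull_iff.1 hf L).comp (hτ.tendsto_atTop.comp hθ.tendsto_atTop)).abs
    have h2 := (tendsto_zero_iff_norm_tendsto_zero.1
      (tendsto_sub_nhds_zero_iff.2 hL)).const_mul M
    have h3 := h1.add h2
    rw [abs_zero, mul_zero, add_zero] at h3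
    have := ge_of_tendsto' h3 fun n => by
      change δ ≤ |f (τ (θ n)) L| + M * ‖a (τ (θ n)) - L‖
      have h4 := hδa (θ n)
      have h5 := ((f (τ (θ n))).le_opNorm (a (τ (θ n)) - L)).trans
        (mul_le_mul_of_nonneg_right (hM _) (norm_nonneg _))
      rw [map_sub, Real.norm_eq_abs] at h5
      have h6 := abs_sub_abs_le_abs_sub (f (τ (θ n)) (a (τ (θ n)))) (f (τ (θ n)) L)
      linarith
    linarith
  rw [Metric.tendsto_atTop]
  intro ε hε
  obtain ⟨u, hu0, hu⟩ := exists_norm_posPart_le_of_disjoint hA.1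
    (fun y hd hy => h y (hA.2 y hy hd)) (ε := ε / (2 * (M + 1))) (by positivity)
  choose a ha1 ha2 using fun n => exists_truncation (x := x n) hu0
  obtain ⟨N, hN⟩ := Metric.tendsto_atTop.1 (hord u a ha1) (ε / 2) (by positivity)
  refine ⟨N, fun n hn => ?_⟩
  have h1 := hN n hn
  rw [Real.dist_eq, sub_zero] at h1 ⊢
  have h2 : ‖x n - a n‖ ≤ ε / (2 * (M + 1)) := (norm_le_norm_of_abs_le (ha2 n)).trans (hu _ (hx n))
  have h3 : |f n (x n - a n)| ≤ ε / 2 := by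
    calc |f n (x n - a n)| ≤ ‖f n‖ * ‖x n - a n‖ := (f n).le_opNorm _
      _ ≤ (M + 1) * (ε / (2 * (M + 1))) := by
        gcongr
        linarith [hM n]
      _ = ε / 2 := by field_simp
  rw [map_sub] at h3
  have h4 := abs_sub_abs_le_abs_sub (f n (x n)) (f n (a n))
  linarith

theorem WeaklyNull.isDisjointlyWeaklyCompact_solidClosure [CompleteSpace E] {x : ℕ → E}
    (hx : WeaklyNull x) (hb : Bornology.IsBounded (Set.range x)) :
    IsDisjointlyWeaklyCompact (LatticeOrderedAddCommGroup.solidClosure (Set.range x)) :=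
  ⟨isBounded_solidClosure hb, fun _ hy hd =>
    hx.of_mem_solidClosure hd fun n => solidClosure_solidClosure_subset _ (hy n)⟩

theorem WeaklyNull.isBounded_range [CompleteSpace E] {x : ℕ → E} (hx : WeaklyNull x) :
    Bornology.IsBounded (Set.range x) := by
  obtain ⟨C, hC⟩ := banach_steinhaus (g := fun n => NormedSpace.inclusionInDoubleDual ℝ E (x n))
    fun ψ => by
      obtain ⟨C, hC⟩ := isBounded_iff_forall_norm_le.1
        (Metric.isBounded_range_of_tendsto _ (weaklyNull_iff.1 hx ψ))
      exact ⟨C, fun n => hC _ ⟨n, rfl⟩⟩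
  refine isBounded_iff_forall_norm_le.2 ⟨C, ?_⟩
  rintro _ ⟨n, rfl⟩
  exact ((NormedSpace.inclusionInDoubleDualLi ℝ (E := E)).norm_map (x n)).symm.le.trans (hC n)

/-- A subsequence bounded below by `δ` is truncated with error `δ / 4` into a compact order
interval. The limit `L` of the truncations is itself within `δ / 4` of the weak limit 0, leaving
norms of at most about `δ / 2`. -/
theorem HasDDPStarProperty.hasSchurProperty [CompleteSpace E] (h : HasDDPStarProperty E)
    (hS : MonotoneSeqCauchy E) : HasSchurProperty E := by
  intro x hx
  have hbdd := hx.isBounded_range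
  have hdwc := hx.isDisjointlyWeaklyCompact_solidClosure hbdd
  have hlim := h _ hdwc
  have hcompact := hS.orderIntervalsCompact (Or.inl h.orderIntervalsLimited)
  rw [tendsto_zero_iff_norm_tendsto_zero]
  by_contra hcon
  obtain ⟨δ, hδ, τ, hτ, hδx⟩ := exists_subseq_of_not_tendsto_zero hcon
  obtain ⟨u, hu0, hu⟩ := exists_norm_posPart_le_of_disjoint hbdd
    (fun y hd hy => hd.tendsto_zero_of_limited hS.orderBoundedDisjointNull
      fun f hf => hlim.tendsto_apply hf hy) (ε := δ / 4) (by positivity)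
  choose a ha1 ha2 using fun n => exists_truncation (x := x (τ n)) hu0
  have hxa : ∀ n, ‖x (τ n) - a n‖ ≤ δ / 4 := fun n =>
    (norm_le_norm_of_abs_le (ha2 n)).trans (hu _ ⟨_, rfl⟩)
  obtain ⟨θ, hθ, L, hL⟩ := hcompact u a ha1
  have haL := tendsto_zero_iff_norm_tendsto_zero.1 (tendsto_sub_nhds_zero_iff.2 hL)
  have hxL : ∀ n, ‖x (τ (θ n)) - L‖ ≤ δ / 4 + ‖a (θ n) - L‖ := fun n => by
    calc ‖x (τ (θ n)) - L‖ = ‖(x (τ (θ n)) - a (θ n)) + (a (θ n) - L)‖ := by congr 1; abel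
      _ ≤ δ / 4 + ‖a (θ n) - L‖ := (norm_add_le _ _).trans (by gcongr; exact hxa _)
  have hLδ : ‖L‖ ≤ δ / 4 := by
    -- A functional norming `L` detects `‖L‖`, up to `δ / 4`, on a weakly null sequence.
    obtain ⟨ψ, hψ1, hψ2⟩ := exists_dual_vector'' ℝ L
    have h1 := ((weaklyNull_iff.1 hx ψ).comp (hτ.tendsto_atTop.comp hθ.tendsto_atTop)).abs
    have h2 := h1.add (haL.const_add (δ / 4))
    rw [abs_zero, zero_add, add_zero] at h2
    refine ge_of_tendsto' h2 fun n => ?_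
    change ‖L‖ ≤ |ψ (x (τ (θ n)))| + (δ / 4 + ‖a (θ n) - L‖)
    have h3 := ψ.le_of_opNorm_le hψ1 (x (τ (θ n)) - L)
    rw [one_mul, map_sub, Real.norm_eq_abs] at h3
    have h4 : ψ L = ‖L‖ := hψ2
    have h5 := abs_sub_abs_le_abs_sub (ψ L) (ψ (x (τ (θ n))))
    rw [abs_sub_comm, h4, abs_norm] at h5
    rw [h4] at h3
    have := hxL n
    linarith
  have h6 := (haL.const_add (δ / 4)).add_const (δ / 4)
  have := ge_of_tendsto' h6 fun n => by
    have h7 := hδx (θ n)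
    rw [abs_norm] at h7
    have h8 := norm_sub_norm_le (x (τ (θ n))) L
    have h9 := hxL n
    show δ ≤ δ / 4 + ‖a (θ n) - L‖ + δ / 4
    linarith
  linarith

end Main

theorem mainTheorem6 (E : Type*) [NormedAddCommGroup E] [NormedSpace ℝ E] [CompleteSpace E]
    [Lattice E] [IsOrderedAddMonoid E] [IsOrderedModule ℝ E] [HasSolidNorm E] :
    List.TFAE
      [HasSchurProperty E,
       HasDDPStarProperty E ∧ HasOrderContinuousNorm E,
       IsSigmaDedekindComplete E ∧ HasDDPStarProperty E] := by
  tfae_have 1 → 2 := fun h => ⟨h.hasDDPStarProperty, h.monotoneSeqCauchy.hasOrderContinuousNorm⟩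
  tfae_have 2 → 3 := fun h => ⟨h.2.monotoneSeqCauchy.isSigmaDedekindComplete, h.1⟩
  tfae_have 3 → 1 := fun h => h.2.hasSchurProperty
    ((orderBoundedDisjointNull_of_limited h.1 h.2.orderIntervalsLimited).monotoneSeqCauchy h.1)
  tfae_finish
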